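/- Notation. For a probability distribution $F$ on $\mathbb R$ write $F^{-1}(p)=\inf\{x: F(x)\ge p\}$, and for $0\le\delta<1/2$ let $\mathcal F_\delta(F)=\{(1-\delta)F+\delta H : H \text{ a probability distribution on } \mathbb R\}$. Let $x_{(1)}\le\dots\le x_{(n)}$ be the order statistics of a sample $X_n=(x_1,\dots,x_n)$ formed by the first $n$ terms of a sequence of i.i.d. observations. For a sequence of intervals $I_n=[a_n(X_n),b_n(X_n)]$ let $$L\{I_n,F,\delta\}=\sup_{G\in\mathcal F_\delta(F)}\operatorname{ess\,sup}_G\ \limsup_n\,(b_n(X_n)-a_n(X_n))\in[-\infty,\infty].$$ The sequence has $\delta$-robust length at $F$ if $L\{I_n,F,\delta\}<\infty$, and its length breakdown point is $\delta^*\{I_n,F\}=\sup\{\delta\in[0,1/2): L\{I_n,F,\delta\}<\infty\}$. Put $\alpha^*(n,k,\varepsilon)=1-P(k<Z_n<n-k)$ with $Z_n\sim\mathrm{Binomial}(n,(1-\varepsilon)/2)$. Theorem 2. Suppose that $F$ has a density that is symmetric around some $\theta$ and unimodal. Let $0<\alpha<1$ and $0\le\varepsilon<1/2$, and for each $n\ge1$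 let $k_n$ be a minimizer of $|\alpha^*(n,k,\varepsilon)-\alpha|$ over the integers $k\ge 0$ with $k+1\le n-k$. Then $\alpha^*(n,k_n,\varepsilon)\to\alpha$, and for the intervals $I_n=[x_{(k_n+1)},x_{(n-k_n)}]$: 1. For $0\le\delta<(1-\varepsilon)/2$, $$L\{I_n,F,\delta\}=F^{-1}\Big(\frac{1+\varepsilon}{2(1-\delta)}\Big)-F^{-1}\Big(\frac{1-\varepsilon}{2(1-\delta)}\Big).$$ 2. $\delta^*\{I_n,F\}=(1-\varepsilon)/2$. 3. The sequence $I_n$ has $\varepsilon$-robust length at $F$ if and only if $\varepsilon<1/3$. 4. Let $[A_n(X_n),B_n(X_n)]$ be any sequence of intervals with measurable endpoints such that, for some numbers $\alpha_n\to\alpha$ and all sufficiently large $n$, $$\inf_{G\in\mathcal F_\varepsilon(G_0)}P_G\{A_n(X_n)\le G_0^{-1}(1/2)<B_n(X_n)\}=1-\alpha_n$$ for every continuous distribution $G_0$ with a unique median (for instance $\alpha_n=\alpha$ for all $n$). If $A_n(X_n)\to A_0$ and $B_n(X_n)\to B_0$ almost surely when the sample comes from $F$, where $A_0,B_0$ are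 real constants, then $B_0\ge F^{-1}((1+\varepsilon)/2)$ and $A_0\le F^{-1}((1-\varepsilon)/2)$. -/

import Mathlib

open MeasureTheory ProbabilityTheory Filter Topology Set
open scoped ENNReal

noncomputable section

namespace RobustInterval

/-- The quantile function `F⁻¹(p) = inf {x : F(x) ≥ p}` of a probability distribution on the line
(used for `0 < p < 1` only, where the set is nonempty and bounded below). -/
def quantile (F : ProbabilityMeasure ℝ) (p : ℝ) : ℝ :=
  sInf {x : ℝ | p ≤ cdf (F : Measure ℝ) x}

/-- `F` has a continuous distribution function and a unique median. -/
def IsContinuousUniqueMedian (F : ProbabilityMeasure ℝ) : Prop :=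
  Continuous (cdf (F : Measure ℝ)) ∧ ∃! x : ℝ, cdf (F : Measure ℝ) x = 1 / 2

/-- `F` has a density with respect to Lebesgue measure that is symmetric around `θ` and unimodal
(nondecreasing up to some mode and nonincreasing after it). The density may take the value `∞`
at its mode, so that unbounded densities are included. Such an `F` is automatically continuous. -/
def HasSymmetricUnimodalDensity (F : ProbabilityMeasure ℝ) (θ : ℝ) : Prop :=
  ∃ f : ℝ → ℝ≥0∞, Measurable f ∧ (F : Measure ℝ) = volume.withDensity f ∧
    (∀ t, f (θ + t) = f (θ - t)) ∧
    ∃ m : ℝ, MonotoneOn f (Iic m) ∧ AntitoneOn f (Ici m)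

/-- The contamination neighborhood of `F` of size `δ`: all `G = (1 - δ) F + δ H`, where `H` is an
arbitrary probability distribution on the line. Contamination fractions satisfy `0 ≤ δ < 1/2`. -/
def contaminationNhd (F : ProbabilityMeasure ℝ) (δ : ℝ) : Set (ProbabilityMeasure ℝ) :=
  {G | ∃ H : ProbabilityMeasure ℝ,
    (G : Measure ℝ) =
      ENNReal.ofReal (1 - δ) • (F : Measure ℝ) + ENNReal.ofReal δ • (H : Measure ℝ)}

/-- The law of an infinite sequence `x₀, x₁, …` of independent observations from `G`. -/
def sampleLaw (G : ProbabilityMeasure ℝ) : Measure (ℕ → ℝ) :=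
  Measure.infinitePi fun _ : ℕ => (G : Measure ℝ)

/-- The sample formed by the first `n` observations. -/
def sample (n : ℕ) (x : ℕ → ℝ) : Fin n → ℝ := fun i => x i

/-- The `j`-th smallest of `n` observations, `1 ≤ j ≤ n` (and `0` for other values of `j`). -/
def orderStat {n : ℕ} (x : Fin n → ℝ) (j : ℕ) : ℝ :=
  if h : 1 ≤ j ∧ j ≤ n then x (Tuple.sort x ⟨j - 1, by omega⟩) else 0

/-- `α*(n, k, ε) = 1 - P(k < Z < n - k)`, where `Z` is binomial with parameters `n` and
`(1 - ε) / 2`. -/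
def alphaStar (n k : ℕ) (ε : ℝ) : ℝ :=
  1 - ∑ i ∈ Finset.Ioo k (n - k),
    (n.choose i : ℝ) * ((1 - ε) / 2) ^ i * (1 - (1 - ε) / 2) ^ (n - i)

/-- `k` minimizes `|α*(n, k, ε) - α|` among the integers `k ≥ 0` for which
`[x_(k+1), x_(n-k)]` is an interval between order statistics, that is, `k + 1 ≤ n - k`. -/
def IsOptimalIndex (α ε : ℝ) (n k : ℕ) : Prop :=
  2 * k < n ∧ ∀ j : ℕ, 2 * j < n → |alphaStar n k ε - α| ≤ |alphaStar n j ε - α|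

/-- The maximum asymptotic length of the intervals `[aₙ, bₙ]` under contamination of size `δ`:
the supremum over the neighborhood of the essential supremum of `limsup (bₙ - aₙ)`. -/
def maxAsymptoticLength (a b : (n : ℕ) → (Fin n → ℝ) → ℝ) (F : ProbabilityMeasure ℝ) (δ : ℝ) :
    EReal :=
  ⨆ G ∈ contaminationNhd F δ,
    essSup (fun x : ℕ → ℝ =>
      limsup (fun n : ℕ => ((b n (sample n x) - a n (sample n x) : ℝ) : EReal)) atTop)
      (sampleLaw G)

/-- The intervals `[aₙ, bₙ]` have `δ`-robust length at `F`. -/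
def HasRobustLength (a b : (n : ℕ) → (Fin n → ℝ) → ℝ) (F : ProbabilityMeasure ℝ) (δ : ℝ) :
    Prop :=
  maxAsymptoticLength a b F δ < ⊤

/-- The length breakdown point: the supremum of the contamination fractions `δ ∈ [0, 1/2)` for
which the intervals have `δ`-robust length. -/
def lengthBreakdownPoint (a b : (n : ℕ) → (Fin n → ℝ) → ℝ) (F : ProbabilityMeasure ℝ) : ℝ :=
  sSup {δ : ℝ | 0 ≤ δ ∧ δ < 1 / 2 ∧ HasRobustLength a b F δ}

/-- The interval `[A, B]` computed from `n` observations has `ε`-robust coverage `1 - α` at `F`: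
the infimum over the neighborhood of the probability that `A ≤ F⁻¹(1/2) < B` equals `1 - α`. -/
def HasRobustCoverage {n : ℕ} (A B : (Fin n → ℝ) → ℝ) (ε α : ℝ) (F : ProbabilityMeasure ℝ) :
    Prop :=
  IsGLB
    ((fun G : ProbabilityMeasure ℝ => (sampleLaw G).real
      {x | A (sample n x) ≤ quantile F (1 / 2) ∧ quantile F (1 / 2) < B (sample n x)}) ''
        contaminationNhd F ε)
    (1 - α)

/-- The interval `[A, B]` has nonparametric `ε`-robust coverage `1 - α`: it has `ε`-robust
coverage `1 - α` at every continuous distribution with a unique median. -/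
def HasNonparametricRobustCoverage {n : ℕ} (A B : (Fin n → ℝ) → ℝ) (ε α : ℝ) : Prop :=
  ∀ F : ProbabilityMeasure ℝ, IsContinuousUniqueMedian F → HasRobustCoverage A B ε α F

/-- The lower endpoints `x_(kₙ+1)`. -/
def lowerEnd (k : ℕ → ℕ) (n : ℕ) (x : Fin n → ℝ) : ℝ := orderStat x (k n + 1)

/-- The upper endpoints `x_(n-kₙ)`. -/
def upperEnd (k : ℕ → ℕ) (n : ℕ) (x : Fin n → ℝ) : ℝ := orderStat x (n - k n)

end RobustInterval

end

/-! The endpoints are order statistics with relative ranks tending to `(1 ∓ ε)/2`, so lengths reduce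
to quantiles. Raising the index by one changes the level by two binomial masses, and the largest
mass vanishes as `n` grows (`exists_bound_binomialMass`). Hence `α` is approximated arbitrarily well
(`tendsto_alphaStar`), and Chebyshev's inequality fixes the limiting rank (`tendsto_index_div`):
otherwise the level would come close to `0` or `1`.

By the strong law, the endpoints are almost surely trapped by points slightly beyond quantiles of `G
= (1 - δ) F + δ H`. The limiting interval has `F`-mass at most `ε / (1 - δ)`, and its endpoints obey
bounds on the tail masses. Symmetry and unimodality make the extreme interval under these
constraints the longest (`IsCenteredDensity.length_le`), and a point mass at its right end attains
it. For `δ > (1 - ε)/2` a remote point mass drags the upper endpoint along. At equality the strong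
law is silent, but the upper endpoint still reaches the point mass with probability at least `1 -
alphaStar n (k n) ε`, whose limit `1 - α` is positive.

For optimality, `F` is an `ε`-contamination of its own conditional laws on an upper and on a lower
half-line, whose medians are the `(1 ± ε)/2` quantiles of `F`. Coverage of these medians under `F`
must stay asymptotically at least `1 - α > 0`, so the limiting interval cannot miss either of them
(`not_ae_eventually_miss`). -/

namespace RobustInterval

/-! ### Binomial probabilities: Chebyshev's bound and uniform smallness -/

/-- The probability that a binomial variable with parameters `n` and `p` equals `i`. -/
noncomputable def binomialMass (n : ℕ) (p : ℝ) (i : ℕ) : ℝ :=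
  (n.choose i : ℝ) * p ^ i * (1 - p) ^ (n - i)

lemma binomialMass_nonneg {n : ℕ} {p : ℝ} (hp₀ : 0 ≤ p) (hp₁ : p ≤ 1) (i : ℕ) :
    0 ≤ binomialMass n p i := by
  have : 0 ≤ 1 - p := by linarith
  unfold binomialMass
  positivity

lemma sum_binomialMass (n : ℕ) (p : ℝ) :
    ∑ i ∈ Finset.range (n + 1), binomialMass n p i = 1 := by
  have := (add_pow p (1 - p) n).symm
  rw [add_sub_cancel, one_pow] at this
  rw [← this]
  refine Finset.sum_congr rfl fun i _ => ?_
  unfold binomialMass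
  ring

lemma sum_sq_mul_binomialMass (n : ℕ) (p : ℝ) :
    ∑ i ∈ Finset.range (n + 1), (n * p - i) ^ 2 * binomialMass n p i = n * p * (1 - p) := by
  have := congrArg (Polynomial.eval p) (bernsteinPolynomial.variance ℝ n)
  simpa [Polynomial.eval_finsetSum, bernsteinPolynomial, binomialMass] using this

/-- Chebyshev's inequality for the binomial distribution. -/
lemma sum_binomialMass_le_of_far {n : ℕ} {p η : ℝ} (hp₀ : 0 ≤ p) (hp₁ : p ≤ 1) (hη : 0 < η)
    (hn : 0 < n) (s : Finset ℕ) (hs : s ⊆ Finset.range (n + 1))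
    (hfar : ∀ i ∈ s, η * n ≤ |n * p - i|) :
    ∑ i ∈ s, binomialMass n p i ≤ 1 / (η ^ 2 * n) := by
  have hn' : (0 : ℝ) < n := by exact_mod_cast hn
  have h₁ : (η * n) ^ 2 * ∑ i ∈ s, binomialMass n p i ≤ n * p * (1 - p) := by
    rw [← sum_sq_mul_binomialMass, Finset.mul_sum]
    refine (Finset.sum_le_sum fun i hi => ?_).trans
      (Finset.sum_le_sum_of_subset_of_nonneg hs fun i _ _ =>
        mul_nonneg (sq_nonneg _) (binomialMass_nonneg hp₀ hp₁ i))
    refine mul_le_mul_of_nonneg_right ?_ (binomialMass_nonneg hp₀ hp₁ i)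
    rw [← sq_abs (n * p - i : ℝ)]
    exact pow_le_pow_left₀ (by positivity) (hfar i hi) 2
  have h₂ : n * p * (1 - p) ≤ n := by
    have : p * (1 - p) ≤ 1 := by nlinarith
    calc n * p * (1 - p) = n * (p * (1 - p)) := by ring
      _ ≤ n * 1 := by gcongr
      _ = n := mul_one _
  rw [le_div_iff₀ (by positivity)]
  have h₃ := h₁.trans h₂
  have h₄ : n * ((∑ i ∈ s, binomialMass n p i) * (η ^ 2 * n)) ≤ n * 1 := by
    calc _ = (η * n) ^ 2 * ∑ i ∈ s, binomialMass n p i := by ring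
      _ ≤ _ := by linarith
  exact le_of_mul_le_mul_left h₄ hn'

lemma integral_exp_int_mul (m : ℤ) :
    ∫ t in (-Real.pi)..Real.pi, Complex.exp (m * Complex.I * t) =
      if m = 0 then 2 * Real.pi else 0 := by
  split_ifs with hm
  · simp [hm]
    ring
  · have hc : (m * Complex.I : ℂ) ≠ 0 := by simp [hm]
    rw [integral_exp_mul_complex hc, Complex.ofReal_zero, div_eq_zero_iff]
    left
    rw [sub_eq_zero, Complex.exp_eq_exp_iff_exists_int]
    exact ⟨m, by push_cast; ring⟩

/-- Fourier inversion: expanding the power by the binomial theorem, orthogonality of the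
exponentials keeps only the `j`-th coefficient. -/
lemma integral_charFun_binomial (n j : ℕ) (p : ℝ) (hj : j ≤ n) :
    ∫ t in (-Real.pi)..Real.pi,
        (p * Complex.exp (Complex.I * t) + (1 - p)) ^ n * Complex.exp (-(j * Complex.I * t)) =
      2 * Real.pi * binomialMass n p j := by
  have h : ∀ t : ℝ, ((p : ℂ) * Complex.exp (Complex.I * t) + (1 - p)) ^ n *
      Complex.exp (-(j * Complex.I * t)) =
      ∑ i ∈ Finset.range (n + 1), (binomialMass n p i : ℂ) *
        Complex.exp (((i : ℤ) - j : ℤ) * Complex.I * t) := by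
    intro t
    rw [add_pow, Finset.sum_mul]
    refine Finset.sum_congr rfl fun i _ => ?_
    have : Complex.exp (((i : ℤ) - j : ℤ) * Complex.I * t) =
        Complex.exp (Complex.I * t) ^ i * Complex.exp (-(j * Complex.I * t)) := by
      rw [← Complex.exp_nat_mul, ← Complex.exp_add]
      congr 1
      push_cast
      ring
    rw [this, binomialMass, mul_pow]
    push_cast
    ring
  simp_rw [h]
  rw [intervalIntegral.integral_finsetSum
    (fun i _ => (by fun_prop : Continuous _).intervalIntegrable _ _)]
  simp_rw [intervalIntegral.integral_const_mul, integral_exp_int_mul]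
  rw [Finset.sum_eq_single j]
  · simp
    ring
  · intro i _ hij
    have : ((i : ℤ) - j) ≠ 0 := by omega
    simp [this]
  · intro hj'
    simp at hj'
    omega

/-- This form shows that for `0 < p < 1` the characteristic function has modulus below `1` except
where `cos t = 1`. -/
lemma normSq_charFun_bernoulli (p t : ℝ) :
    ‖(p : ℂ) * Complex.exp (Complex.I * t) + (1 - p)‖ ^ 2 =
      1 - 2 * (p * (1 - p)) * (1 - Real.cos t) := by
  rw [← Complex.normSq_eq_norm_sq, mul_comm Complex.I, Complex.exp_mul_I, Complex.normSq_apply,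
    ← Complex.ofReal_cos, ← Complex.ofReal_sin]
  simp only [Complex.add_re, Complex.mul_re, Complex.ofReal_re, Complex.ofReal_im, Complex.add_im,
    Complex.mul_im, Complex.I_re, Complex.I_im, Complex.sub_re, Complex.sub_im, Complex.one_re,
    Complex.one_im]
  linear_combination p ^ 2 * Real.sin_sq_add_cos_sq t

/-- The largest binomial probability tends to zero. -/
lemma exists_bound_binomialMass {p : ℝ} (hp₀ : 0 < p) (hp₁ : p < 1) :
    ∃ M : ℕ → ℝ, Tendsto M atTop (𝓝 0) ∧ ∀ n j, j ≤ n → binomialMass n p j ≤ M n := by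
  set φ : ℝ → ℝ := fun t => ‖(p : ℂ) * Complex.exp (Complex.I * t) + (1 - p)‖ with hφ
  have hpq : 0 < p * (1 - p) := mul_pos hp₀ (by linarith)
  have hφ₁ : ∀ t, φ t ≤ 1 := fun t => by
    refine (sq_le_one_iff₀ (norm_nonneg _)).1 ?_
    rw [normSq_charFun_bernoulli]
    nlinarith [Real.cos_le_one t]
  have hφ₂ : ∀ t, t ∈ Ioo (-Real.pi) Real.pi → t ≠ 0 → φ t < 1 := fun t ht h0 => by
    refine (sq_lt_one_iff₀ (norm_nonneg _)).1 ?_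
    rw [normSq_charFun_bernoulli]
    have : Real.cos t ≠ 1 := fun h => h0 <|
      (Real.cos_eq_one_iff_of_lt_of_lt (by linarith [ht.1, Real.pi_pos])
        (by linarith [ht.2, Real.pi_pos])).1 h
    have := lt_of_le_of_ne (Real.cos_le_one t) this
    nlinarith
  have hφc : Continuous φ := by fun_prop
  refine ⟨fun n => (∫ t in (-Real.pi)..Real.pi, φ t ^ n) / (2 * Real.pi), ?_, ?_⟩
  · have : Tendsto (fun n : ℕ => ∫ t in (-Real.pi)..Real.pi, φ t ^ n) atTop
        (𝓝 (∫ t in (-Real.pi)..Real.pi, (0 : ℝ))) := by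
      refine intervalIntegral.tendsto_integral_filter_of_dominated_convergence (fun _ => 1)
        (Eventually.of_forall fun n => (hφc.pow n).aestronglyMeasurable)
        (Eventually.of_forall fun n => Eventually.of_forall fun t _ => ?_)
        intervalIntegrable_const ?_
      · rw [Real.norm_of_nonneg (by positivity)]
        exact pow_le_one₀ (norm_nonneg _) (hφ₁ t)
      -- Only `t = 0` obstructs convergence; `π` is discarded merely to land in the open interval
      -- required by `hφ₂`.
      · have h1 : ∀ᵐ t : ℝ, t ≠ 0 := by simp [ae_iff]
        have h2 : ∀ᵐ t : ℝ, t ≠ Real.pi := by simp [ae_iff]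
        filter_upwards [h1, h2] with t ht0 htπ ht
        rw [uIoc_of_le (by linarith [Real.pi_pos])] at ht
        exact tendsto_pow_atTop_nhds_zero_of_lt_one (norm_nonneg _)
          (hφ₂ t ⟨ht.1, lt_of_le_of_ne ht.2 htπ⟩ ht0)
    simpa using this.div_const (2 * Real.pi)
  · intro n j hj
    rw [le_div_iff₀ (by positivity)]
    have h := congrArg norm (integral_charFun_binomial n j p hj)
    have h' : ‖(2 * Real.pi * binomialMass n p j : ℂ)‖ = 2 * Real.pi * binomialMass n p j := by
      rw [norm_mul, norm_mul, Complex.norm_real, Complex.norm_real,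
        Real.norm_of_nonneg (binomialMass_nonneg hp₀.le hp₁.le j),
        Real.norm_of_nonneg Real.pi_pos.le]
      simp
    rw [h'] at h
    rw [mul_comm, ← h]
    refine (intervalIntegral.norm_integral_le_integral_norm (by linarith [Real.pi_pos])).trans
      (le_of_eq ?_)
    refine intervalIntegral.integral_congr fun t _ => ?_
    have : ‖Complex.exp (-(j * Complex.I * t))‖ = 1 := by
      rw [Complex.norm_exp]
      simp
    simp [hφ, this]

/-! ### Levels and indices of the optimal intervals -/

lemma alphaStar_eq (n k : ℕ) (ε : ℝ) :
    alphaStar n k ε = 1 - ∑ i ∈ Finset.Ioo k (n - k), binomialMass n ((1 - ε) / 2) i := rfl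

lemma sum_binomialMass_compl (n : ℕ) (p : ℝ) (s : Finset ℕ) (hs : s ⊆ Finset.range (n + 1)) :
    1 - ∑ i ∈ s, binomialMass n p i = ∑ i ∈ Finset.range (n + 1) \ s, binomialMass n p i := by
  rw [← sum_binomialMass n p, ← Finset.sum_sdiff hs]
  ring

lemma Ioo_subset_range (n k : ℕ) : Finset.Ioo k (n - k) ⊆ Finset.range (n + 1) := by
  intro i
  simp
  omega

section

variable {ε : ℝ}

/-- Index `0` omits at most the two extreme masses. This provides a level below `α` from which to
search for the crossing. -/
lemma alphaStar_zero_tendsto (hε₀ : 0 ≤ ε) (hε₁ : ε < 1 / 2) :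
    Tendsto (fun n => alphaStar n 0 ε) atTop (𝓝 0) := by
  set p := (1 - ε) / 2 with hp
  obtain ⟨M, hM, hM'⟩ := exists_bound_binomialMass (p := p) (by linarith) (by linarith)
  have h2 : Tendsto (fun n => M n + M n) atTop (𝓝 0) := by simpa using hM.add hM
  have hp₀ : 0 ≤ p := by linarith
  have hp₁ : p ≤ 1 := by linarith
  refine tendsto_of_tendsto_of_tendsto_of_le_of_le tendsto_const_nhds h2 (fun n => ?_) fun n => ?_
  · dsimp only
    rw [alphaStar_eq, sum_binomialMass_compl _ _ _ (Ioo_subset_range n 0)]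
    exact Finset.sum_nonneg fun i _ => binomialMass_nonneg hp₀ hp₁ i
  · dsimp only
    rw [alphaStar_eq, sum_binomialMass_compl _ _ _ (Ioo_subset_range n 0)]
    have hsub : Finset.range (n + 1) \ Finset.Ioo 0 (n - 0) ⊆ {0, n} := by
      intro i
      simp
      omega
    refine (Finset.sum_le_sum_of_subset_of_nonneg hsub fun i _ _ =>
      binomialMass_nonneg hp₀ hp₁ i).trans ?_
    have h0 := hM' n 0 (Nat.zero_le n)
    have hn := hM' n n le_rfl
    by_cases hz : n = 0
    · subst hz
      simp
      have := binomialMass_nonneg (n := 0) hp₀ hp₁ 0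
      linarith
    · rw [Finset.sum_pair (by omega)]
      linarith

/-- The levels of the optimal intervals converge to the nominal one. -/
lemma tendsto_alphaStar {α : ℝ} {k : ℕ → ℕ} (hα₀ : 0 < α) (hα₁ : α < 1) (hε₀ : 0 ≤ ε)
    (hε₁ : ε < 1 / 2) (hk : ∀ n : ℕ, 1 ≤ n → IsOptimalIndex α ε n (k n)) :
    Tendsto (fun n : ℕ => alphaStar n (k n) ε) atTop (𝓝 α) := by
  set p := (1 - ε) / 2 with hp
  have hp₀ : 0 ≤ p := by linarith
  have hp₁ : p ≤ 1 := by linarith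
  obtain ⟨M, hM, hM'⟩ := exists_bound_binomialMass (p := p) (by linarith) (by linarith)
  have h2 : Tendsto (fun n => M n + M n) atTop (𝓝 0) := by simpa using hM.add hM
  rw [tendsto_iff_dist_tendsto_zero]
  refine squeeze_zero' (Eventually.of_forall fun n => dist_nonneg) ?_ h2
  filter_upwards [(alphaStar_zero_tendsto hε₀ hε₁).eventually_lt_const hα₀,
    hM.eventually_lt_const (sub_pos.2 hα₁), eventually_ge_atTop 1] with n h0 hMn hn
  -- At the largest admissible index the open range contains at most `n / 2`, so the level is at
  -- least `1 - M n`, which exceeds `α`.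
  have hex : ∃ j, 2 * j < n ∧ α ≤ alphaStar n j ε := by
    refine ⟨(n - 1) / 2, by omega, ?_⟩
    rw [alphaStar_eq]
    have hsub : Finset.Ioo ((n - 1) / 2) (n - (n - 1) / 2) ⊆ {n / 2} := by
      intro i
      simp
      omega
    have := Finset.sum_le_sum_of_subset_of_nonneg hsub fun i _ _ =>
      binomialMass_nonneg (n := n) hp₀ hp₁ i
    rw [Finset.sum_singleton] at this
    have := hM' n (n / 2) (Nat.div_le_self _ _)
    linarith
  classical
  obtain ⟨hj, hjα⟩ := Nat.find_spec hex
  -- At the first index whose level reaches `α`, the overshoot is at most one step, and the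
  -- minimizer does no worse than this index.
  set j := Nat.find hex with hjdef
  have hj0 : j ≠ 0 := by
    intro h
    rw [h] at hjα
    linarith
  obtain ⟨i, hi⟩ := Nat.exists_eq_succ_of_ne_zero hj0
  have hiα : alphaStar n i ε < α := by
    by_contra hcon
    exact Nat.find_min hex (m := i) (by omega) ⟨by omega, not_lt.1 hcon⟩
  have hstep : alphaStar n j ε ≤ alphaStar n i ε + (M n + M n) := by
    rw [alphaStar_eq, alphaStar_eq, hi]
    have hsub : Finset.Ioo i (n - i) ⊆ Finset.Ioo (i + 1) (n - (i + 1)) ∪ {i + 1, n - (i + 1)} := by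
      intro l
      simp
      omega
    have h := (Finset.sum_le_sum_of_subset_of_nonneg hsub fun i _ _ =>
      binomialMass_nonneg (n := n) hp₀ hp₁ i)
    rw [Finset.sum_union (by
      rw [Finset.disjoint_left]
      intro l
      simp
      omega), Finset.sum_pair (by omega)] at h
    have h1 := hM' n (i + 1) (by omega)
    have h2 := hM' n (n - (i + 1)) (by omega)
    simp only [Nat.succ_eq_add_one]
    linarith
  rw [Real.dist_eq]
  refine ((hk n hn).2 j hj).trans ?_
  rw [abs_of_nonneg (by linarith)]
  linarith

/-- The index of the lower order statistic is asymptotically `n (1 - ε) / 2`. -/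
lemma tendsto_index_div {α : ℝ} {k : ℕ → ℕ} (hα₀ : 0 < α) (hα₁ : α < 1) (hε₀ : 0 ≤ ε)
    (hε₁ : ε < 1 / 2) (hk : ∀ n : ℕ, 1 ≤ n → IsOptimalIndex α ε n (k n)) :
    Tendsto (fun n : ℕ => (k n : ℝ) / n) atTop (𝓝 ((1 - ε) / 2)) := by
  set p := (1 - ε) / 2 with hp
  have hp₀ : 0 ≤ p := by linarith
  have hp₁ : p ≤ 1 := by linarith
  have hα := tendsto_alphaStar hα₀ hα₁ hε₀ hε₁ hk
  rw [Metric.tendsto_nhds]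
  intro η hη
  have hlim : Tendsto (fun n : ℕ => 1 / (η ^ 2 * n)) atTop (𝓝 0) :=
    tendsto_const_nhds.div_atTop
      (tendsto_natCast_atTop_atTop.const_mul_atTop (by positivity))
  have hup := hα.add hlim
  have hlo := hα.sub hlim
  rw [add_zero] at hup
  rw [sub_zero] at hlo
  filter_upwards [hup.eventually_lt_const hα₁, hlo.eventually_const_lt hα₀,
    eventually_ge_atTop 1] with n h1 h2 hn
  have hn' : (0 : ℝ) < n := by exact_mod_cast hn
  have hkn := (hk n hn).1
  rw [alphaStar_eq] at h1
  rw [alphaStar_eq, sum_binomialMass_compl _ _ _ (Ioo_subset_range n _)] at h2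
  rw [Real.dist_eq, abs_lt]
  constructor
  -- If `k n` is too small, all omitted counts lie far from the mean (the upper ones because `p ≤
  -- 1/2`), so the level would be nearly `0`.
  · by_contra hcon
    have hcon : (k n : ℝ) ≤ (p - η) * n := by
      rw [← div_le_iff₀ hn']
      linarith
    have := sum_binomialMass_le_of_far hp₀ hp₁ hη hn
      (Finset.range (n + 1) \ Finset.Ioo (k n) (n - k n)) Finset.sdiff_subset (fun i hi => by
        rw [Finset.mem_sdiff, Finset.mem_range, Finset.mem_Ioo] at hi
        rcases le_or_gt i (k n) with hik | hik
        · have : (i : ℝ) ≤ k n := by exact_mod_cast hik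
          exact le_abs.2 (Or.inl (by linarith))
        · have : n ≤ i + k n := by omega
          have : (n : ℝ) ≤ i + k n := by exact_mod_cast this
          exact le_abs.2 (Or.inr (by nlinarith)))
    linarith
  -- If `k n` is too large, all retained counts lie far above the mean, so the level would be nearly
  -- `1`.
  · by_contra hcon
    have hcon : (p + η) * n ≤ k n := by
      rw [← le_div_iff₀ hn']
      linarith
    have := sum_binomialMass_le_of_far hp₀ hp₁ hη hn
      (Finset.Ioo (k n) (n - k n)) (Ioo_subset_range n _) (fun i hi => by
        rw [Finset.mem_Ioo] at hi
        have : (k n : ℝ) ≤ i := by exact_mod_cast hi.1.le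
        exact le_abs.2 (Or.inr (by linarith)))
    linarith

end

/-! ### Empirical counts under the sample law -/

instance (G : ProbabilityMeasure ℝ) : IsProbabilityMeasure (sampleLaw G) := by
  unfold sampleLaw
  infer_instance

open Classical in
/-- The number of observations among the first `n` that lie in `S`. -/
noncomputable def countIn (S : Set ℝ) (n : ℕ) (x : ℕ → ℝ) : ℕ :=
  ((Finset.range n).filter (x · ∈ S)).card

lemma countIn_add_compl (S : Set ℝ) (n : ℕ) (x : ℕ → ℝ) :
    countIn S n x + countIn Sᶜ n x = n := by
  classical
  have := Finset.card_filter_add_card_filter_not (s := Finset.range n) (x · ∈ S)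
  simpa [countIn] using this

lemma countIn_mono {S T : Set ℝ} (h : S ⊆ T) (n : ℕ) (x : ℕ → ℝ) :
    countIn S n x ≤ countIn T n x := by
  classical
  exact Finset.card_le_card (Finset.monotone_filter_right _ fun _ _ h' => h h')

lemma countIn_eq_sum (S : Set ℝ) (n : ℕ) (x : ℕ → ℝ) :
    (countIn S n x : ℝ) = ∑ i ∈ Finset.range n, S.indicator (fun _ => (1 : ℝ)) (x i) := by
  classical
  simp [countIn, indicator_apply, Finset.sum_boole]

lemma measurable_countIn {S : Set ℝ} (hS : MeasurableSet S) (n : ℕ) :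
    Measurable (countIn S n) := by
  have h : Measurable fun x : ℕ → ℝ => (countIn S n x : ℝ) := by
    simp_rw [countIn_eq_sum]
    exact Finset.measurable_fun_sum _ fun i _ =>
      (measurable_const.indicator hS).comp (measurable_pi_apply i)
  refine measurable_to_countable' fun m => ?_
  have := h (measurableSet_singleton (m : ℝ))
  convert this using 1
  ext x
  simp

/-- Empirical frequencies converge almost surely. -/
lemma ae_tendsto_countIn_div (G : ProbabilityMeasure ℝ) {S : Set ℝ} (hS : MeasurableSet S) :
    ∀ᵐ x ∂(sampleLaw G), Tendsto (fun n : ℕ => (countIn S n x : ℝ) / n) atTop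
      (𝓝 ((G : Measure ℝ).real S)) := by
  set f : ℝ → ℝ := S.indicator fun _ => (1 : ℝ) with hf
  have hfm : Measurable f := measurable_const.indicator hS
  have hlaw : ∀ i : ℕ, MeasurePreserving (Function.eval i) (sampleLaw G) (G : Measure ℝ) :=
    fun i => measurePreserving_eval_infinitePi (fun _ : ℕ => (G : Measure ℝ)) i
  have hid : ∀ i : ℕ, IdentDistrib (fun x : ℕ → ℝ => f (x i)) (fun x : ℕ → ℝ => f (x 0))
      (sampleLaw G) (sampleLaw G) := fun i => by
    have : IdentDistrib (Function.eval i : (ℕ → ℝ) → ℝ) (Function.eval 0)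
        (sampleLaw G) (sampleLaw G) :=
      ⟨(measurable_pi_apply i).aemeasurable, (measurable_pi_apply 0).aemeasurable,
        by rw [(hlaw i).map_eq, (hlaw 0).map_eq]⟩
    exact this.comp hfm
  have hindep : iIndepFun (fun (i : ℕ) (x : ℕ → ℝ) => f (x i)) (sampleLaw G) :=
    iIndepFun_infinitePi (P := fun _ : ℕ => (G : Measure ℝ)) (X := fun _ => f) fun _ => hfm
  have hint : Integrable (fun x : ℕ → ℝ => f (x 0)) (sampleLaw G) := by
    refine Integrable.of_bound (C := 1)
      (hfm.comp (measurable_pi_apply 0)).aestronglyMeasurable (Eventually.of_forall fun x => ?_)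
    by_cases hx : x 0 ∈ S <;> simp [hf, hx]
  have h := strong_law_ae_real (fun (i : ℕ) (x : ℕ → ℝ) => f (x i)) hint
    (fun i j hij => hindep.indepFun hij) hid
  have hval : ∫ x, f (x 0) ∂(sampleLaw G) = (G : Measure ℝ).real S := by
    have := (hlaw 0).map_eq
    calc ∫ x, f (x 0) ∂(sampleLaw G)
        = ∫ y, f y ∂((sampleLaw G).map (Function.eval 0)) :=
          (integral_map (measurable_pi_apply 0).aemeasurable hfm.aestronglyMeasurable).symm
      _ = ∫ y, f y ∂(G : Measure ℝ) := by rw [this]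
      _ = _ := by rw [hf, integral_indicator_const _ hS, smul_eq_mul, mul_one]
  rw [hval] at h
  filter_upwards [h] with x hx
  simpa only [countIn_eq_sum] using hx

/-- The number of observations in `S` has a binomial distribution. -/
lemma sampleLaw_countIn_eq (G : ProbabilityMeasure ℝ) {S : Set ℝ} (hS : MeasurableSet S)
    (n i : ℕ) :
    (sampleLaw G).real {x | countIn S n x = i} = binomialMass n ((G : Measure ℝ).real S) i := by
  classical
  -- Fixing exactly which observations fall in `S` gives a cylinder, whose probability is a product.
  have hcell : ∀ T ∈ (Finset.range n).powersetCard i,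
      {x : ℕ → ℝ | (Finset.range n).filter (x · ∈ S) = T} =
        ((Finset.range n : Finset ℕ) : Set ℕ).pi fun j => if j ∈ T then S else Sᶜ := by
    intro T hT
    have hT := (Finset.mem_powersetCard.1 hT).1
    ext x
    simp only [mem_ofPred_eq, Set.mem_pi, Finset.mem_coe, Finset.ext_iff, Finset.mem_filter]
    constructor
    · intro h j hj
      have := h j
      split_ifs with hjT
      · exact (this.2 hjT).2
      · exact fun hx => hjT (this.1 ⟨hj, hx⟩)
    · intro h j
      constructor
      · rintro ⟨hj, hx⟩
        by_contra hjT
        have := h j hj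
        rw [if_neg hjT] at this
        exact this hx
      · intro hjT
        have := h j (hT hjT)
        rw [if_pos hjT] at this
        exact ⟨hT hjT, this⟩
  have hmeasS : ∀ (T : Finset ℕ) (j : ℕ), MeasurableSet (if j ∈ T then S else Sᶜ) := by
    intro T j
    split_ifs
    exacts [hS, hS.compl]
  have hunion : {x : ℕ → ℝ | countIn S n x = i} =
      ⋃ T ∈ (Finset.range n).powersetCard i,
        {x : ℕ → ℝ | (Finset.range n).filter (x · ∈ S) = T} := by
    ext x
    simp [countIn]
  rw [hunion, measureReal_biUnion_finset]
  · have : ∀ T ∈ (Finset.range n).powersetCard i,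
        (sampleLaw G).real {x : ℕ → ℝ | (Finset.range n).filter (x · ∈ S) = T} =
          (G : Measure ℝ).real S ^ i * (1 - (G : Measure ℝ).real S) ^ (n - i) := by
      intro T hT
      rw [hcell T hT, measureReal_def, sampleLaw, Measure.infinitePi_pi _ fun j _ => hmeasS T j,
        ENNReal.toReal_prod]
      obtain ⟨hTs, hTc⟩ := Finset.mem_powersetCard.1 hT
      have : ∀ j ∈ Finset.range n, ((G : Measure ℝ) (if j ∈ T then S else Sᶜ)).toReal =
          if j ∈ T then (G : Measure ℝ).real S else 1 - (G : Measure ℝ).real S := by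
        intro j _
        split_ifs
        · rfl
        · exact probReal_compl_eq_one_sub hS
      rw [Finset.prod_congr rfl this, Finset.prod_ite, Finset.prod_const, Finset.prod_const]
      have h1 : (Finset.range n).filter (· ∈ T) = T := by
        ext j
        simpa using fun h => Finset.mem_range.1 (hTs h)
      have h2 : ((Finset.range n).filter (· ∉ T)).card = n - i := by
        have := Finset.card_filter_add_card_filter_not (s := Finset.range n) (· ∈ T)
        rw [h1, hTc, Finset.card_range] at this
        omega
      rw [h1, h2, hTc]
    rw [Finset.sum_congr rfl this, Finset.sum_const, Finset.card_powersetCard, Finset.card_range,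
      nsmul_eq_mul, binomialMass, mul_assoc]
  · intro T _ T' _ hne
    rw [Function.onFun, Set.disjoint_left]
    rintro x rfl h
    exact hne h
  · intro T hT
    rw [hcell T hT]
    exact MeasurableSet.pi (Finset.countable_toSet _) fun j _ => hmeasS T j

lemma sum_binomialMass_le_sampleLaw (G : ProbabilityMeasure ℝ) {S : Set ℝ} (hS : MeasurableSet S)
    (n k : ℕ) (s : Finset ℕ) (hs : ∀ i ∈ s, k < i) :
    ∑ i ∈ s, binomialMass n ((G : Measure ℝ).real S) i ≤
      (sampleLaw G).real {x | k < countIn S n x} := by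
  simp_rw [← sampleLaw_countIn_eq G hS]
  rw [← measureReal_biUnion_finset]
  · refine measureReal_mono ?_
    intro x
    simp only [mem_iUnion, mem_ofPred_eq, exists_prop, forall_exists_index, and_imp]
    rintro i hi rfl
    exact hs _ hi
  · intro i _ j _ hne
    rw [Function.onFun, Set.disjoint_left]
    rintro x rfl h
    exact hne h
  · intro i _
    exact measurable_countIn hS n (measurableSet_singleton i)

/-! ### Order statistics expressed through counts -/

lemma orderStat_le_iff {n j : ℕ} (h₁ : 1 ≤ j) (h₂ : j ≤ n) (x : ℕ → ℝ) (t : ℝ) :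
    orderStat (sample n x) j ≤ t ↔ j ≤ countIn (Iic t) n x := by
  classical
  have hmono := Tuple.monotone_sort (sample n x)
  have h := Tuple.lt_card_le_iff_apply_le_of_monotone (j := ⟨j - 1, by omega⟩) (a := t) hmono
  rw [orderStat, dif_pos ⟨h₁, h₂⟩]
  refine h.symm.trans ?_
  have hcard : (Finset.univ.filter fun i => (sample n x ∘ Tuple.sort (sample n x)) i ≤ t).card =
      countIn (Iic t) n x := by
    rw [countIn]
    refine Finset.card_bij (fun i _ => (Tuple.sort (sample n x) i : ℕ)) ?_ ?_ ?_
    · intro i hi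
      exact Finset.mem_filter.2 ⟨Finset.mem_range.2 (Fin.is_lt _), (Finset.mem_filter.1 hi).2⟩
    · intro i _ i' _ h
      exact (Tuple.sort (sample n x)).injective (Fin.ext h)
    · intro i hi
      obtain ⟨hi, hit⟩ := Finset.mem_filter.1 hi
      refine ⟨(Tuple.sort (sample n x)).symm ⟨i, Finset.mem_range.1 hi⟩,
        Finset.mem_filter.2 ⟨Finset.mem_univ _, ?_⟩, ?_⟩
      · simpa [sample] using hit
      · simp
  rw [hcard]
  simp only
  omega

section

variable {j : ℕ → ℕ} {r t : ℝ}

/-- The strict gap between `r` and the limiting frequency of `Iic t` eventually puts at least `j n`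
observations there. -/
lemma ae_eventually_orderStat_le (G : ProbabilityMeasure ℝ) (hj : ∀ n, 1 ≤ n → 1 ≤ j n ∧ j n ≤ n)
    (hr : Tendsto (fun n => (j n : ℝ) / n) atTop (𝓝 r)) (ht : r < cdf (G : Measure ℝ) t) :
    ∀ᵐ x ∂(sampleLaw G), ∀ᶠ n in atTop, orderStat (sample n x) (j n) ≤ t := by
  filter_upwards [ae_tendsto_countIn_div G (measurableSet_Iic (a := t))] with x hx
  rw [← cdf_eq_real] at hx
  filter_upwards [hr.eventually_lt hx ht, eventually_ge_atTop 1] with n hn h1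
  have : (0 : ℝ) < n := by exact_mod_cast h1
  rw [orderStat_le_iff (hj n h1).1 (hj n h1).2]
  rw [div_lt_div_iff_of_pos_right this] at hn
  exact_mod_cast hn.le

lemma ae_eventually_lt_orderStat (G : ProbabilityMeasure ℝ) (hj : ∀ n, 1 ≤ n → 1 ≤ j n ∧ j n ≤ n)
    (hr : Tendsto (fun n => (j n : ℝ) / n) atTop (𝓝 r)) (ht : cdf (G : Measure ℝ) t < r) :
    ∀ᵐ x ∂(sampleLaw G), ∀ᶠ n in atTop, t < orderStat (sample n x) (j n) := by
  filter_upwards [ae_tendsto_countIn_div G (measurableSet_Iic (a := t))] with x hx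
  rw [← cdf_eq_real] at hx
  filter_upwards [hx.eventually_lt hr ht, eventually_ge_atTop 1] with n hn h1
  have : (0 : ℝ) < n := by exact_mod_cast h1
  rw [← not_le, orderStat_le_iff (hj n h1).1 (hj n h1).2]
  rw [div_lt_div_iff_of_pos_right this] at hn
  exact not_le.2 (by exact_mod_cast hn)

end

/-- More than `k` observations at `T` force the `(n - k)`-th order statistic up to `T`. -/
lemma le_orderStat_of_lt_countIn {n k : ℕ} (hk : k < n) (x : ℕ → ℝ) {T : ℝ}
    (h : k < countIn {T} n x) : T ≤ orderStat (sample n x) (n - k) := by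
  refine le_of_forall_lt fun t ht => ?_
  rw [← not_le, orderStat_le_iff (by omega) (by omega), not_le]
  have h1 := countIn_add_compl (Iic t) n x
  have h2 : countIn {T} n x ≤ countIn (Iic t)ᶜ n x :=
    countIn_mono (by simpa using ht) n x
  omega

/-- The indicators tend to zero almost everywhere and the measure is finite. This turns almost sure
statements into bounds on probabilities. -/
lemma tendsto_measureReal_zero_of_ae_eventually_notMem {Ω : Type*} [MeasurableSpace Ω]
    {μ : Measure Ω} [IsFiniteMeasure μ] {E : ℕ → Set Ω} (hE : ∀ n, MeasurableSet (E n))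
    (h : ∀ᵐ x ∂μ, ∀ᶠ n in atTop, x ∉ E n) : Tendsto (fun n => μ.real (E n)) atTop (𝓝 0) := by
  have := tendsto_measure_of_ae_tendsto_indicator_of_isFiniteMeasure (μ := μ) atTop
    (A := ∅) MeasurableSet.empty hE (by
      filter_upwards [h] with x hx
      filter_upwards [hx] with n hn
      simpa using hn)
  have h' := (ENNReal.tendsto_toReal (by simp)).comp this
  simpa [measureReal_def, Function.comp_def] using h'

/-! ### Quantiles of distributions on the line -/

section quantile

variable (G : ProbabilityMeasure ℝ) {p : ℝ}

lemma cdf_sub_cdf {a b : ℝ} (hab : a ≤ b) :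
    cdf (G : Measure ℝ) b - cdf (G : Measure ℝ) a = (G : Measure ℝ).real (Ioc a b) := by
  rw [cdf_eq_real, cdf_eq_real, ← Iic_union_Ioc_eq_Iic hab,
    measureReal_union (Iic_disjoint_Ioc le_rfl) measurableSet_Ioc]
  ring

lemma exists_lt_cdf (hp : p < 1) : ∃ t, p < cdf (G : Measure ℝ) t :=
  ((tendsto_cdf_atTop (G : Measure ℝ)).eventually_const_lt hp).exists

lemma exists_cdf_lt (hp : 0 < p) : ∃ t, cdf (G : Measure ℝ) t < p :=
  ((tendsto_cdf_atBot (G : Measure ℝ)).eventually_lt_const hp).exists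

lemma bddBelow_le_cdf (hp : 0 < p) : BddBelow {x : ℝ | p ≤ cdf (G : Measure ℝ) x} := by
  obtain ⟨t, ht⟩ := exists_cdf_lt G hp
  refine ⟨t, fun x hx => ?_⟩
  by_contra hcon
  exact absurd (monotone_cdf (G : Measure ℝ) (not_le.1 hcon).le) (not_le.2 (ht.trans_le hx))

lemma quantile_le_iff (hp₀ : 0 < p) (hp₁ : p < 1) (t : ℝ) :
    quantile G p ≤ t ↔ p ≤ cdf (G : Measure ℝ) t := by
  constructor
  · intro h
    refine le_trans ?_ (monotone_cdf (G : Measure ℝ) h)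
    have hne : {x : ℝ | p ≤ cdf (G : Measure ℝ) x}.Nonempty :=
      (exists_lt_cdf G hp₁).imp fun t ht => ht.le
    have hright := (cdf (G : Measure ℝ)).right_continuous (quantile G p)
    refine ge_of_tendsto (hright.mono_left (nhdsWithin_mono _ Ioi_subset_Ici_self)) ?_
    filter_upwards [self_mem_nhdsWithin] with s hs
    obtain ⟨u, hu, hus⟩ := exists_lt_of_csInf_lt hne (show sInf _ < s from hs)
    exact hu.trans (monotone_cdf (G : Measure ℝ) hus.le)
  · exact fun h => csInf_le (bddBelow_le_cdf G hp₀) h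

lemma lt_quantile_iff (hp₀ : 0 < p) (hp₁ : p < 1) (t : ℝ) :
    t < quantile G p ↔ cdf (G : Measure ℝ) t < p := by
  rw [← not_le, quantile_le_iff G hp₀ hp₁, not_le]

lemma continuous_cdf [NullSingletonClass (G : Measure ℝ)] : Continuous (cdf (G : Measure ℝ)) := by
  rw [continuous_iff_continuousAt]
  intro x
  rw [(monotone_cdf (G : Measure ℝ)).continuousAt_iff_leftLim_eq_rightLim,
    StieltjesFunction.rightLim_eq]
  have h := (cdf (G : Measure ℝ)).measure_singleton x
  rw [measure_cdf, measure_singleton] at h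
  have h1 := ENNReal.ofReal_eq_zero.1 h.symm
  have h2 := (monotone_cdf (G : Measure ℝ)).leftLim_le (le_refl x)
  linarith

lemma cdf_quantile (hc : Continuous (cdf (G : Measure ℝ))) (hp₀ : 0 < p) (hp₁ : p < 1) :
    cdf (G : Measure ℝ) (quantile G p) = p := by
  refine le_antisymm ?_ ((quantile_le_iff G hp₀ hp₁ _).1 le_rfl)
  refine le_of_tendsto ((hc.tendsto (quantile G p)).mono_left (nhdsWithin_le_nhds (s := Iio (quantile G p)))) ?_
  filter_upwards [self_mem_nhdsWithin] with t ht
  exact ((lt_quantile_iff G hp₀ hp₁ t).1 ht).le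

end quantile

/-! ### Symmetric unimodal densities and lengths of intervals -/

/-- `f` is a density of `F` that is symmetric around `θ`, with mode `θ`. -/
structure IsCenteredDensity (F : ProbabilityMeasure ℝ) (θ : ℝ) (f : ℝ → ℝ≥0∞) : Prop where
  measurable : Measurable f
  eq_withDensity : (F : Measure ℝ) = volume.withDensity f
  symm_add : ∀ t, f (θ + t) = f (θ - t)
  antitoneOn : AntitoneOn f (Ici θ)

/-- The given mode `m` need not be `θ`. If `m ≤ θ`, restrict the decreasing branch; if `θ ≤ m`,
reflect the increasing one. -/
lemma HasSymmetricUnimodalDensity.exists_isCenteredDensity {F : ProbabilityMeasure ℝ} {θ : ℝ}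
    (h : HasSymmetricUnimodalDensity F θ) : ∃ f, IsCenteredDensity F θ f := by
  obtain ⟨f, hf, hF, hs, m, hm, ha⟩ := h
  refine ⟨f, hf, hF, hs, ?_⟩
  rcases le_total m θ with hmθ | hmθ
  · exact ha.mono (Ici_subset_Ici.2 hmθ)
  · intro x hx y hy hxy
    have hx' := hs (x - θ)
    have hy' := hs (y - θ)
    rw [add_sub_cancel] at hx' hy'
    rw [hx', hy']
    simp only [mem_Ici] at hx hy
    exact hm (by simp only [mem_Iic]; linarith) (by simp only [mem_Iic]; linarith) (by linarith)

namespace IsCenteredDensity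

variable {F : ProbabilityMeasure ℝ} {θ : ℝ} {f : ℝ → ℝ≥0∞} (h : IsCenteredDensity F θ f)
include h

lemma noAtoms : NullSingletonClass (F : Measure ℝ) := by
  rw [h.eq_withDensity]
  infer_instance

lemma continuous_cdf : Continuous (cdf (F : Measure ℝ)) :=
  have := h.noAtoms
  RobustInterval.continuous_cdf F

lemma apply_eq_lintegral {s : Set ℝ} (hs : MeasurableSet s) :
    (F : Measure ℝ) s = ∫⁻ t in s, f t := by
  rw [h.eq_withDensity, withDensity_apply _ hs]

lemma symm_sub (x : ℝ) : f (2 * θ - x) = f x := by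
  have := h.symm_add (x - θ)
  rw [add_sub_cancel] at this
  rw [this]
  congr 1
  ring

lemma le_of_abs_le {x y : ℝ} (hxy : |x - θ| ≤ |y - θ|) : f y ≤ f x := by
  have key : ∀ z, f z = f (θ + |z - θ|) := by
    intro z
    rcases le_total θ z with hz | hz
    · rw [abs_of_nonneg (by linarith), add_sub_cancel]
    · rw [abs_of_nonpos (by linarith), ← h.symm_sub z]
      congr 1
      ring
  rw [key x, key y]
  exact h.antitoneOn (by simp) (by simp) (by linarith)

lemma cdf_reflect (x : ℝ) :
    cdf (F : Measure ℝ) (2 * θ - x) = 1 - cdf (F : Measure ℝ) x := by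
  have hno := h.noAtoms
  have h1 : (F : Measure ℝ) (Iic (2 * θ - x)) = (F : Measure ℝ) (Ici x) := by
    rw [h.apply_eq_lintegral measurableSet_Iic, h.apply_eq_lintegral measurableSet_Ici,
      ← (Measure.measurePreserving_sub_left volume (2 * θ)).setLIntegral_comp_preimage
        measurableSet_Iic h.measurable]
    simp_rw [h.symm_sub]
    congr 2
    ext y
    simp
  have h2 : (F : Measure ℝ) (Ici x) = (F : Measure ℝ) (Iic x)ᶜ := by
    rw [compl_Iic]
    exact (measure_congr Ioi_ae_eq_Ici).symm
  rw [cdf_eq_real, cdf_eq_real, measureReal_def, h1, h2, ← measureReal_def,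
    probReal_compl_eq_one_sub measurableSet_Iic]

/-- Mass beyond `b` forces the density to be positive at some `y > b`; decreasing away from `θ`, it
is then at least `f y` on `Ioc (max a θ) b`. -/
lemma cdf_lt_cdf_of_center_lt {a b : ℝ} (hab : a < b) (hb : θ < b)
    (hb₁ : cdf (F : Measure ℝ) b < 1) : cdf (F : Measure ℝ) a < cdf (F : Measure ℝ) b := by
  have hpos : ∃ y, b < y ∧ f y ≠ 0 := by
    by_contra! hcon
    have h0 : (F : Measure ℝ) (Ioi b) = 0 := by
      rw [h.apply_eq_lintegral measurableSet_Ioi, setLIntegral_congr_fun measurableSet_Ioi hcon]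
      simp
    have h1 : (F : Measure ℝ).real (Iic b)ᶜ = 0 := by
      rw [compl_Iic, measureReal_def, h0, ENNReal.toReal_zero]
    rw [probReal_compl_eq_one_sub measurableSet_Iic, ← cdf_eq_real] at h1
    linarith
  obtain ⟨y, hby, hy⟩ := hpos
  have hle : f y * volume (Ioc (max a θ) b) ≤ (F : Measure ℝ) (Ioc a b) := by
    calc f y * volume (Ioc (max a θ) b) = ∫⁻ _ in Ioc (max a θ) b, f y := by
          rw [setLIntegral_const]
      _ ≤ ∫⁻ t in Ioc (max a θ) b, f t := by
          refine setLIntegral_mono h.measurable fun t ht => ?_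
          have ht' := (max_lt_iff.1 ht.1).2
          exact h.antitoneOn ht'.le (hb.trans hby).le (ht.2.trans hby.le)
      _ = (F : Measure ℝ) (Ioc (max a θ) b) := (h.apply_eq_lintegral measurableSet_Ioc).symm
      _ ≤ _ := measure_mono (Ioc_subset_Ioc_left (le_max_left _ _))
  have hlt : 0 < (F : Measure ℝ) (Ioc a b) := by
    refine lt_of_lt_of_le ?_ hle
    rw [Real.volume_Ioc]
    exact ENNReal.mul_pos hy (by simpa using ⟨hab, hb⟩)
  have := cdf_sub_cdf F hab.le
  have hr : 0 < (F : Measure ℝ).real (Ioc a b) :=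
    ENNReal.toReal_pos hlt.ne' (measure_ne_top _ _)
  linarith

/-- The distribution function is strictly increasing where it is neither `0` nor `1`. -/
lemma cdf_lt_cdf {a b : ℝ} (hab : a < b) (ha₀ : 0 < cdf (F : Measure ℝ) a)
    (hb₁ : cdf (F : Measure ℝ) b < 1) : cdf (F : Measure ℝ) a < cdf (F : Measure ℝ) b := by
  rcases lt_or_ge θ b with hb | hb
  · exact h.cdf_lt_cdf_of_center_lt hab hb hb₁
  · have h1 := h.cdf_reflect a
    have h2 := h.cdf_reflect b
    have := h.cdf_lt_cdf_of_center_lt (a := 2 * θ - b) (b := 2 * θ - a) (by linarith)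
      (by linarith) (by linarith)
    linarith

/-- Intervals of fixed length gain mass when they are shifted towards the center. -/
lemma cdf_sub_le_of_shift {a b s : ℝ} (hs : 0 ≤ s) (hab : a ≤ b) (hc : 2 * θ ≤ a + b - 2 * s) :
    cdf (F : Measure ℝ) b - cdf (F : Measure ℝ) a ≤
      cdf (F : Measure ℝ) (b - s) - cdf (F : Measure ℝ) (a - s) := by
  have key : (F : Measure ℝ).real (Ioc (b - s) b) ≤ (F : Measure ℝ).real (Ioc (a - s) a) := by
    refine ENNReal.toReal_mono (measure_ne_top _ _) ?_
    rw [h.apply_eq_lintegral measurableSet_Ioc, h.apply_eq_lintegral measurableSet_Ioc,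
      ← (measurePreserving_add_right volume (b - a)).setLIntegral_comp_preimage
        measurableSet_Ioc h.measurable]
    have hpre : (fun x => x + (b - a)) ⁻¹' Ioc (b - s) b = Ioc (a - s) a := by
      ext x
      simp only [mem_preimage, mem_Ioc]
      constructor <;> rintro ⟨h1, h2⟩ <;> constructor <;> linarith
    rw [hpre]
    -- The midpoint condition says that each point of the left piece is no farther from `θ` than its
    -- translate in the right piece.
    refine setLIntegral_mono h.measurable fun t ht => h.le_of_abs_le ?_
    rw [abs_le]
    have h1 := le_abs_self (t + (b - a) - θ)
    constructor <;> linarith [ht.1, ht.2]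
  have h1 := cdf_sub_cdf F (a := b - s) (b := b) (by linarith)
  have h2 := cdf_sub_cdf F (a := a - s) (b := a) (by linarith)
  linarith

/-- The bound on `F b` gives `b ≤ y`. Shift `[x, y]` left until its right end is `b`: it gains mass,
so were `[a, b]` longer, it would contain strictly more mass still, against `hmass`. -/
lemma length_le_of_center_le {a b x y : ℝ} (hxy : x ≤ y)
    (hc : 2 * θ ≤ x + y) (hc' : 2 * θ ≤ a + b) (hy₁ : cdf (F : Measure ℝ) y < 1)
    (hmass : cdf (F : Measure ℝ) b - cdf (F : Measure ℝ) a ≤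
      cdf (F : Measure ℝ) y - cdf (F : Measure ℝ) x)
    (hb : cdf (F : Measure ℝ) b ≤ cdf (F : Measure ℝ) y) (ha : 0 < cdf (F : Measure ℝ) a) :
    b - a ≤ y - x := by
  have hby : b ≤ y := by
    by_contra! hcon
    have := h.cdf_lt_cdf_of_center_lt hcon (by linarith) (by linarith)
    linarith
  by_contra! hcon
  have h1 := h.cdf_sub_le_of_shift (a := x) (b := y) (s := y - b) (by linarith) hxy (by linarith)
  rw [sub_sub_cancel] at h1
  have h2 := monotone_cdf (F : Measure ℝ) (show x - (y - b) ≤ b by linarith)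
  have h3 := h.cdf_lt_cdf (a := a) (b := x - (y - b)) (by linarith) ha (by linarith)
  linarith

/-- Among the intervals with at most a given mass and with tail masses bounded below, the
longest is the extreme one. -/
lemma length_le {a b x y : ℝ} (hxy : x ≤ y) (hc : 2 * θ ≤ x + y)
    (hy₁ : cdf (F : Measure ℝ) y < 1)
    (hmass : cdf (F : Measure ℝ) b - cdf (F : Measure ℝ) a ≤
      cdf (F : Measure ℝ) y - cdf (F : Measure ℝ) x)
    (hb : cdf (F : Measure ℝ) b ≤ cdf (F : Measure ℝ) y)
    (ha : 1 - cdf (F : Measure ℝ) y ≤ cdf (F : Measure ℝ) a) :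
    b - a ≤ y - x := by
  rcases le_total (2 * θ) (a + b) with hc' | hc'
  · exact h.length_le_of_center_le hxy hc hc' hy₁ hmass hb (by linarith)
  · have h1 := h.cdf_reflect a
    have h2 := h.cdf_reflect b
    have := h.length_le_of_center_le (a := 2 * θ - b) (b := 2 * θ - a) hxy hc
      (by linarith) hy₁ (by linarith) (by linarith) (by linarith)
    linarith

end IsCenteredDensity

/-! ### Approximation in the extended reals, and mixtures -/

lemma ereal_le_of_forall_pos {x : EReal} {c : ℝ} (h : ∀ η : ℝ, 0 < η → x ≤ ((c + η : ℝ) : EReal)) :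
    x ≤ (c : EReal) := by
  have hlim : Tendsto (fun η : ℝ => ((c + η : ℝ) : EReal)) (𝓝[>] 0) (𝓝 (c : EReal)) := by
    have : Continuous fun η : ℝ => ((c + η : ℝ) : EReal) :=
      continuous_coe_real_ereal.comp (by fun_prop)
    simpa using (this.tendsto 0).mono_left nhdsWithin_le_nhds
  refine ge_of_tendsto hlim ?_
  filter_upwards [self_mem_nhdsWithin] with η hη
  exact h η hη

lemma ereal_le_of_forall_pos_sub {x : EReal} {c : ℝ}
    (h : ∀ η : ℝ, 0 < η → ((c - η : ℝ) : EReal) ≤ x) : (c : EReal) ≤ x := by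
  have hlim : Tendsto (fun η : ℝ => ((c - η : ℝ) : EReal)) (𝓝[>] 0) (𝓝 (c : EReal)) := by
    have : Continuous fun η : ℝ => ((c - η : ℝ) : EReal) :=
      continuous_coe_real_ereal.comp (by fun_prop)
    simpa using (this.tendsto 0).mono_left nhdsWithin_le_nhds
  refine le_of_tendsto hlim ?_
  filter_upwards [self_mem_nhdsWithin] with η hη
  exact h η hη

section contamination

variable {F G H : ProbabilityMeasure ℝ} {δ : ℝ}

lemma real_eq_of_mixture (hδ₀ : 0 ≤ δ) (hδ₁ : δ ≤ 1)
    (h : (G : Measure ℝ) =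
      ENNReal.ofReal (1 - δ) • (F : Measure ℝ) + ENNReal.ofReal δ • (H : Measure ℝ)) (s : Set ℝ) :
    (G : Measure ℝ).real s = (1 - δ) * (F : Measure ℝ).real s + δ * (H : Measure ℝ).real s := by
  rw [h, measureReal_add_apply (by simp [ENNReal.mul_eq_top]) (by simp [ENNReal.mul_eq_top])]
  simp [measureReal_ennreal_smul_apply, ENNReal.toReal_ofReal, hδ₀, hδ₁]

lemma exists_mixture (F H : ProbabilityMeasure ℝ) (hδ₀ : 0 ≤ δ) (hδ₁ : δ ≤ 1) :
    ∃ G : ProbabilityMeasure ℝ, (G : Measure ℝ) =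
      ENNReal.ofReal (1 - δ) • (F : Measure ℝ) + ENNReal.ofReal δ • (H : Measure ℝ) := by
  refine ⟨⟨ENNReal.ofReal (1 - δ) • (F : Measure ℝ) + ENNReal.ofReal δ • (H : Measure ℝ), ⟨?_⟩⟩,
    rfl⟩
  simp only [Measure.add_apply, Measure.smul_apply, measure_univ, smul_eq_mul, mul_one]
  rw [← ENNReal.ofReal_add (by linarith) hδ₀]
  simp

/-- Contamination by a point mass at `T`. -/
lemma exists_mixture_dirac (F : ProbabilityMeasure ℝ) (T : ℝ) (hδ₀ : 0 ≤ δ) (hδ₁ : δ ≤ 1) :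
    ∃ G ∈ contaminationNhd F δ,
      (∀ t < T, cdf (G : Measure ℝ) t = (1 - δ) * cdf (F : Measure ℝ) t) ∧
      (∀ t, (1 - δ) * cdf (F : Measure ℝ) t ≤ cdf (G : Measure ℝ) t) ∧
      (G : Measure ℝ).real {T} = (1 - δ) * (F : Measure ℝ).real {T} + δ := by
  let H : ProbabilityMeasure ℝ := ⟨Measure.dirac T, inferInstance⟩
  obtain ⟨G, hG⟩ := exists_mixture F H hδ₀ hδ₁
  have hH : (H : Measure ℝ) = Measure.dirac T := rfl
  have hreal := real_eq_of_mixture hδ₀ hδ₁ hG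
  refine ⟨G, ⟨H, hG⟩, fun t ht => ?_, fun t => ?_, ?_⟩
  · rw [cdf_eq_real, cdf_eq_real, hreal, hH, measureReal_def (Measure.dirac T),
      Measure.dirac_apply' _ measurableSet_Iic]
    simp [ht]
  · rw [cdf_eq_real, cdf_eq_real, hreal]
    have : 0 ≤ δ * (H : Measure ℝ).real (Iic t) := mul_nonneg hδ₀ measureReal_nonneg
    linarith
  · rw [hreal, hH, measureReal_def (Measure.dirac T)]
    simp

end contamination

lemma le_essSup_of_ae {Ω : Type*} [MeasurableSpace Ω] {μ : Measure Ω} [NeZero μ]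
    {f : Ω → EReal} {c : EReal} (h : ∀ᵐ x ∂μ, c ≤ f x) : c ≤ essSup f μ := by
  obtain ⟨x, h1, h2⟩ := (h.and (ae_le_essSup (f := f) (μ := μ))).exists
  exact h1.trans h2

/-! ### Asymptotic length and its breakdown -/

section index

variable {α ε : ℝ} {k : ℕ → ℕ} (hk : ∀ n : ℕ, 1 ≤ n → IsOptimalIndex α ε n (k n))
include hk

lemma lowerIndex_mem (n : ℕ) (hn : 1 ≤ n) : 1 ≤ k n + 1 ∧ k n + 1 ≤ n := by
  have := (hk n hn).1
  omega

lemma upperIndex_mem (n : ℕ) (hn : 1 ≤ n) : 1 ≤ n - k n ∧ n - k n ≤ n := by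
  have := (hk n hn).1
  omega

variable (hα₀ : 0 < α) (hα₁ : α < 1) (hε₀ : 0 ≤ ε) (hε₁ : ε < 1 / 2)
include hα₀ hα₁ hε₀ hε₁

lemma tendsto_lowerIndex_div :
    Tendsto (fun n : ℕ => ((k n + 1 : ℕ) : ℝ) / n) atTop (𝓝 ((1 - ε) / 2)) := by
  have := (tendsto_index_div hα₀ hα₁ hε₀ hε₁ hk).add tendsto_one_div_atTop_nhds_zero_nat
  rw [add_zero] at this
  refine this.congr fun n => ?_
  push_cast
  ring

lemma tendsto_upperIndex_div :
    Tendsto (fun n : ℕ => ((n - k n : ℕ) : ℝ) / n) atTop (𝓝 ((1 + ε) / 2)) := by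
  have := (tendsto_index_div hα₀ hα₁ hε₀ hε₁ hk).const_sub 1
  rw [show 1 - (1 - ε) / 2 = (1 + ε) / 2 by ring] at this
  refine this.congr' ?_
  filter_upwards [eventually_ge_atTop 1] with n hn
  have h1 := (hk n hn).1
  have h2 : (n : ℝ) ≠ 0 := by
    have : (0 : ℝ) < n := by exact_mod_cast hn
    exact this.ne'
  rw [Nat.cast_sub (by omega), sub_div, div_self h2]

lemma ae_eventually_lowerEnd_le (G : ProbabilityMeasure ℝ) {t : ℝ}
    (ht : (1 - ε) / 2 < cdf (G : Measure ℝ) t) :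
    ∀ᵐ x ∂(sampleLaw G), ∀ᶠ n in atTop, lowerEnd k n (sample n x) ≤ t :=
  ae_eventually_orderStat_le G (lowerIndex_mem hk)
    (tendsto_lowerIndex_div hk hα₀ hα₁ hε₀ hε₁) ht

lemma ae_eventually_lt_lowerEnd (G : ProbabilityMeasure ℝ) {t : ℝ}
    (ht : cdf (G : Measure ℝ) t < (1 - ε) / 2) :
    ∀ᵐ x ∂(sampleLaw G), ∀ᶠ n in atTop, t < lowerEnd k n (sample n x) :=
  ae_eventually_lt_orderStat G (lowerIndex_mem hk)
    (tendsto_lowerIndex_div hk hα₀ hα₁ hε₀ hε₁) ht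

lemma ae_eventually_upperEnd_le (G : ProbabilityMeasure ℝ) {t : ℝ}
    (ht : (1 + ε) / 2 < cdf (G : Measure ℝ) t) :
    ∀ᵐ x ∂(sampleLaw G), ∀ᶠ n in atTop, upperEnd k n (sample n x) ≤ t :=
  ae_eventually_orderStat_le G (upperIndex_mem hk)
    (tendsto_upperIndex_div hk hα₀ hα₁ hε₀ hε₁) ht

lemma ae_eventually_lt_upperEnd (G : ProbabilityMeasure ℝ) {t : ℝ}
    (ht : cdf (G : Measure ℝ) t < (1 + ε) / 2) :
    ∀ᵐ x ∂(sampleLaw G), ∀ᶠ n in atTop, t < upperEnd k n (sample n x) :=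
  ae_eventually_lt_orderStat G (upperIndex_mem hk)
    (tendsto_upperIndex_div hk hα₀ hα₁ hε₀ hε₁) ht

/-- Almost surely, the asymptotic length is at most the distance of any two points beyond the
limiting quantiles. -/
lemma essSup_length_le (G : ProbabilityMeasure ℝ) {s t : ℝ}
    (hs : cdf (G : Measure ℝ) s < (1 - ε) / 2) (ht : (1 + ε) / 2 < cdf (G : Measure ℝ) t) :
    essSup (fun x : ℕ → ℝ => limsup (fun n : ℕ =>
      ((upperEnd k n (sample n x) - lowerEnd k n (sample n x) : ℝ) : EReal)) atTop)
      (sampleLaw G) ≤ ((t - s : ℝ) : EReal) := by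
  refine essSup_le_of_ae_le _ ?_
  filter_upwards [ae_eventually_lt_lowerEnd hk hα₀ hα₁ hε₀ hε₁ G hs,
    ae_eventually_upperEnd_le hk hα₀ hα₁ hε₀ hε₁ G ht] with x h1 h2
  refine limsup_le_of_le (by isBoundedDefault) ?_
  filter_upwards [h1, h2] with n h1 h2
  exact EReal.coe_le_coe_iff.2 (by linarith)

lemma le_essSup_length (G : ProbabilityMeasure ℝ) {s t : ℝ}
    (hs : (1 - ε) / 2 < cdf (G : Measure ℝ) s) (ht : cdf (G : Measure ℝ) t < (1 + ε) / 2) :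
    ((t - s : ℝ) : EReal) ≤ essSup (fun x : ℕ → ℝ => limsup (fun n : ℕ =>
      ((upperEnd k n (sample n x) - lowerEnd k n (sample n x) : ℝ) : EReal)) atTop)
      (sampleLaw G) := by
  refine le_essSup_of_ae ?_
  filter_upwards [ae_eventually_lowerEnd_le hk hα₀ hα₁ hε₀ hε₁ G hs,
    ae_eventually_lt_upperEnd hk hα₀ hα₁ hε₀ hε₁ G ht] with x h1 h2
  refine le_limsup_of_frequently_le (Eventually.frequently ?_) (by isBoundedDefault)
  filter_upwards [h1, h2] with n h1 h2
  exact EReal.coe_le_coe_iff.2 (by linarith)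

/-- The maximum asymptotic length below the breakdown point. -/
lemma maxAsymptoticLength_eq {F : ProbabilityMeasure ℝ} {θ : ℝ}
    (hF : HasSymmetricUnimodalDensity F θ) {δ : ℝ} (hδ₀ : 0 ≤ δ) (hδ₁ : δ < (1 - ε) / 2) :
    maxAsymptoticLength (lowerEnd k) (upperEnd k) F δ =
      ((quantile F ((1 + ε) / (2 * (1 - δ))) - quantile F ((1 - ε) / (2 * (1 - δ))) : ℝ) :
        EReal) := by
  obtain ⟨f, hf⟩ := hF.exists_isCenteredDensity
  have hδ : 0 < 1 - δ := by linarith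
  set V := (1 + ε) / (2 * (1 - δ)) with hV
  set U := (1 - ε) / (2 * (1 - δ)) with hU
  have hV' : (1 - δ) * V = (1 + ε) / 2 := by
    rw [hV]
    field_simp
  have hU' : (1 - δ) * U = (1 - ε) / 2 := by
    rw [hU]
    field_simp
  have hU₀ : 0 < U := by
    rw [hU]
    exact div_pos (by linarith) (by linarith)
  have hUV : U ≤ V := by
    rw [hU, hV]
    exact div_le_div_of_nonneg_right (by linarith) (by linarith)
  have hV₁ : V < 1 := by
    rw [hV, div_lt_one (by linarith)]
    linarith
  have hcont := hf.continuous_cdf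
  have hx := cdf_quantile F hcont hU₀ (hUV.trans_lt hV₁)
  have hy := cdf_quantile F hcont (hU₀.trans_le hUV) hV₁
  have hVmin := lt_quantile_iff F (hU₀.trans_le hUV) hV₁
  set x := quantile F U with hxdef
  set y := quantile F V with hydef
  have hxy : x ≤ y := by
    rw [hxdef, quantile_le_iff F hU₀ (hUV.trans_lt hV₁), hy]
    exact hUV
  -- Since `U + V = 1 / (1 - δ) ≥ 1`, the midpoint of `[x, y]` cannot lie left of the center.
  have hc : 2 * θ ≤ x + y := by
    by_contra! hcon
    have h1 := hf.cdf_reflect y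
    have h2 := hf.cdf_lt_cdf (a := x) (b := 2 * θ - y) (by linarith) (by linarith) (by linarith)
    have h3 : (1 - δ) * (U + V) = 1 := by
      rw [mul_add, hU', hV']
      ring
    nlinarith
  refine le_antisymm (iSup₂_le fun G hG => ?_) ?_
  · obtain ⟨H, hGH⟩ := hG
    have hreal := real_eq_of_mixture hδ₀ (by linarith) hGH
    have hcdf : ∀ t, cdf (G : Measure ℝ) t =
        (1 - δ) * cdf (F : Measure ℝ) t + δ * cdf (H : Measure ℝ) t := fun t => by
      simp only [cdf_eq_real, hreal]
    have hp₀ : 0 < (1 - ε) / 2 := by linarith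
    have hp₁ : (1 - ε) / 2 < 1 := by linarith
    set a := quantile G ((1 - ε) / 2) with ha
    have hane := lt_quantile_iff G hp₀ hp₁
    have haG := (quantile_le_iff G hp₀ hp₁ a).1 ha.ge
    -- `G` may be flat at level `(1 + ε) / 2`, so the upper endpoint is controlled only by points
    -- where that level is strictly exceeded.
    set B := {t : ℝ | (1 + ε) / 2 < cdf (G : Measure ℝ) t} with hB
    have hBne : B.Nonempty := exists_lt_cdf G (by linarith)
    have hBa : ∀ t ∈ B, a ≤ t := fun t ht => by
      rw [ha, quantile_le_iff G hp₀ hp₁]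
      have : (1 + ε) / 2 < cdf (G : Measure ℝ) t := ht
      linarith
    have hBbdd : BddBelow B := ⟨a, hBa⟩
    set b := sInf B with hb
    have hab : a ≤ b := le_csInf hBne hBa
    have hbelow : ∀ t < b, cdf (G : Measure ℝ) t ≤ (1 + ε) / 2 := fun t ht =>
      not_lt.1 fun h => absurd (csInf_le hBbdd (show t ∈ B from h)) (not_le.2 ht)
    have hlimb : Tendsto (cdf (F : Measure ℝ)) (𝓝[<] b) (𝓝 (cdf (F : Measure ℝ) b)) :=
      (hcont.tendsto b).mono_left nhdsWithin_le_nhds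
    -- `G` may jump at `b`; its bound holds only to the left, and continuity of `F` carries it to
    -- the limit.
    have hFb : cdf (F : Measure ℝ) b ≤ cdf (F : Measure ℝ) y := by
      refine le_of_tendsto hlimb ?_
      filter_upwards [self_mem_nhdsWithin] with t ht
      have h1 := hbelow t ht
      rw [hcdf] at h1
      have h2 := mul_nonneg hδ₀ (cdf_nonneg (H : Measure ℝ) t)
      rw [hy]
      nlinarith
    have hFa : 1 - cdf (F : Measure ℝ) y ≤ cdf (F : Measure ℝ) a := by
      rw [hcdf] at haG
      have h2 := mul_le_mul_of_nonneg_left (cdf_le_one (H : Measure ℝ) a) hδ₀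
      rw [hy]
      nlinarith
    have hmass : cdf (F : Measure ℝ) b - cdf (F : Measure ℝ) a ≤
        cdf (F : Measure ℝ) y - cdf (F : Measure ℝ) x := by
      rcases hab.eq_or_lt with hab' | hab'
      · rw [← hab', hx, hy]
        linarith
      -- The contaminant's share of `Ioc a t` is nonnegative, so `(1 - δ)` times the `F`-mass there
      -- is at most its `G`-mass, itself at most `ε`.
      · refine le_of_tendsto (hlimb.sub_const _) ?_
        filter_upwards [self_mem_nhdsWithin, Ioo_mem_nhdsLT hab'] with t ht hat
        have h1 := hbelow t ht
        rw [hcdf] at h1 haG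
        have h2 := mul_le_mul_of_nonneg_left (monotone_cdf (H : Measure ℝ) hat.1.le) hδ₀
        rw [hx, hy]
        nlinarith
    have hlen := hf.length_le hxy hc (by rw [hy]; exact hV₁) hmass hFb hFa
    refine ereal_le_of_forall_pos fun η hη => ?_
    obtain ⟨t, ht, htb⟩ := exists_lt_of_csInf_lt hBne (show sInf B < b + η / 2 by linarith)
    refine (essSup_length_le hk hα₀ hα₁ hε₀ hε₁ G
      ((hane (a - η / 2)).1 (by linarith)) ht).trans ?_
    exact EReal.coe_le_coe_iff.2 (by linarith)
  -- With all contamination at `y`, `G` equals `(1 - δ) F` to the left of `y`, so level `(1 + ε) /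
  -- 2` is not reached before `y`, while the lower endpoint stays near or below `x`.
  · obtain ⟨G, hG, hG₁, hG₂, -⟩ := exists_mixture_dirac F y hδ₀ (by linarith)
    refine le_trans ?_ (le_iSup₂_of_le G hG le_rfl)
    refine ereal_le_of_forall_pos_sub fun η hη => ?_
    have hs : (1 - ε) / 2 < cdf (G : Measure ℝ) (x + η / 2) := by
      refine lt_of_lt_of_le ?_ (hG₂ _)
      rw [← hU']
      refine mul_lt_mul_of_pos_left ?_ hδ
      rcases lt_or_ge (cdf (F : Measure ℝ) (x + η / 2)) 1 with h1 | h1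
      · rw [← hx]
        exact hf.cdf_lt_cdf (by linarith) (by linarith) h1
      · linarith
    have ht : cdf (G : Measure ℝ) (y - η / 2) < (1 + ε) / 2 := by
      rw [hG₁ _ (by linarith), ← hV']
      exact mul_lt_mul_of_pos_left ((hVmin _).1 (by linarith)) hδ
    refine le_trans (le_of_eq ?_) (le_essSup_length hk hα₀ hα₁ hε₀ hε₁ G hs ht)
    congr 1
    ring

/-- From the breakdown point on, a remote point mass makes the length arbitrarily large. -/
lemma maxAsymptoticLength_eq_top {F : ProbabilityMeasure ℝ} {θ : ℝ}
    (hF : HasSymmetricUnimodalDensity F θ) {δ : ℝ} (hδ₀ : (1 - ε) / 2 ≤ δ) (hδ₁ : δ < 1 / 2) :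
    maxAsymptoticLength (lowerEnd k) (upperEnd k) F δ = ⊤ := by
  obtain ⟨f, hf⟩ := hF.exists_isCenteredDensity
  have hp : (1 - ε) / 2 < 1 - δ := by linarith
  have hδ : 0 < 1 - δ := by linarith
  obtain ⟨s, hs⟩ := exists_lt_cdf F (p := (1 - ε) / 2 / (1 - δ)) (by rwa [div_lt_one hδ])
  rw [div_lt_iff₀ hδ, mul_comm] at hs
  rw [EReal.eq_top_iff_forall_lt]
  intro C
  -- The lower endpoint is eventually at most `s` and the upper one has to pass `T - 1`, giving
  -- length `C + 1`.
  set T := s + C + 2 with hT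
  obtain ⟨G, hG, hG₁, hG₂, hG₃⟩ := exists_mixture_dirac F T (δ := δ) (by linarith) (by linarith)
  have hGs := hs.trans_le (hG₂ s)
  have hlt : (C : EReal) < ((T - s - 1 : ℝ) : EReal) := EReal.coe_lt_coe_iff.2 (by linarith)
  refine hlt.trans_le (le_trans ?_ (le_iSup₂_of_le G hG le_rfl))
  rcases hδ₀.eq_or_lt with hδ₀ | hδ₀
  -- Here the count at `T` is binomial with the very parameter defining `alphaStar`. A length
  -- essentially below `T - s - 1` would make the event `k n < countIn {T} n x` have vanishing
  -- probability, yet its limit inferior is at least `1 - α`.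
  · by_contra! hcon
    have hno := hf.noAtoms
    have hGT : (G : Measure ℝ).real {T} = (1 - ε) / 2 := by
      rw [hG₃, measureReal_def, measure_singleton, hδ₀]
      simp
    have hE := tendsto_measureReal_zero_of_ae_eventually_notMem (μ := sampleLaw G)
      (E := fun n => {x | k n < countIn {T} n x})
      (fun n => measurable_countIn (measurableSet_singleton T) n measurableSet_Ioi) (by
        filter_upwards [ae_eventually_lowerEnd_le hk hα₀ hα₁ hε₀ hε₁ G hGs,
          ae_le_essSup (μ := sampleLaw G) (f := fun x : ℕ → ℝ => limsup (fun n : ℕ =>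
            ((upperEnd k n (sample n x) - lowerEnd k n (sample n x) : ℝ) : EReal)) atTop)]
          with x h1 h2
        filter_upwards [h1, eventually_lt_of_limsup_lt (h2.trans_lt hcon),
          eventually_ge_atTop 1] with n h1 h2 hn hmem
        have h3 := le_orderStat_of_lt_countIn (by have := (hk n hn).1; omega) x hmem
        have h4 := EReal.coe_lt_coe_iff.1 h2
        simp only [upperEnd] at h4
        linarith)
    have hα := (tendsto_alphaStar hα₀ hα₁ hε₀ hε₁ hk).const_sub 1
    have := le_of_tendsto_of_tendsto' hα hE fun n => by
      have := sum_binomialMass_le_sampleLaw G (measurableSet_singleton T) n (k n)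
        (Finset.Ioo (k n) (n - k n)) fun i hi => (Finset.mem_Ioo.1 hi).1
      rw [hGT] at this
      rw [alphaStar_eq]
      linarith
    linarith
  · refine le_trans ?_ (le_essSup_length hk hα₀ hα₁ hε₀ hε₁ G hGs (t := T - 1) ?_)
    · exact EReal.coe_le_coe_iff.2 (by linarith)
    · rw [hG₁ _ (by linarith)]
      have := mul_le_mul_of_nonneg_left (cdf_le_one (F : Measure ℝ) (T - 1)) hδ.le
      linarith

lemma hasRobustLength_iff {F : ProbabilityMeasure ℝ} {θ : ℝ}
    (hF : HasSymmetricUnimodalDensity F θ) {δ : ℝ} (hδ₀ : 0 ≤ δ) (hδ₁ : δ < 1 / 2) :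
    HasRobustLength (lowerEnd k) (upperEnd k) F δ ↔ δ < (1 - ε) / 2 := by
  unfold HasRobustLength
  constructor
  · intro h
    by_contra! hcon
    rw [maxAsymptoticLength_eq_top hk hα₀ hα₁ hε₀ hε₁ hF hcon hδ₁] at h
    exact lt_irrefl _ h
  · intro h
    rw [maxAsymptoticLength_eq hk hα₀ hα₁ hε₀ hε₁ hF hδ₀ h]
    exact EReal.coe_lt_top _

lemma lengthBreakdownPoint_eq {F : ProbabilityMeasure ℝ} {θ : ℝ}
    (hF : HasSymmetricUnimodalDensity F θ) :
    lengthBreakdownPoint (lowerEnd k) (upperEnd k) F = (1 - ε) / 2 := by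
  have : {δ : ℝ | 0 ≤ δ ∧ δ < 1 / 2 ∧ HasRobustLength (lowerEnd k) (upperEnd k) F δ} =
      Ico 0 ((1 - ε) / 2) := by
    ext δ
    constructor
    · rintro ⟨h0, h1, h2⟩
      exact ⟨h0, (hasRobustLength_iff hk hα₀ hα₁ hε₀ hε₁ hF h0 h1).1 h2⟩
    · rintro ⟨h0, h1⟩
      have h2 : δ < 1 / 2 := by linarith
      exact ⟨h0, h2, (hasRobustLength_iff hk hα₀ hα₁ hε₀ hε₁ hF h0 h2).2 h1⟩
  rw [lengthBreakdownPoint, this, csSup_Ico (by linarith)]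

end index

/-! ### Conditional laws having `F` as a contamination, and optimality -/

/-- `F` lies in the contamination neighborhood of its conditional distribution given an event of
probability `1 - ε`. -/
lemma exists_mem_contaminationNhd_of_real_eq (F : ProbabilityMeasure ℝ) {ε : ℝ} (hε₀ : 0 ≤ ε)
    (hε₁ : ε < 1) {S : Set ℝ} (hS : MeasurableSet S) (hFS : (F : Measure ℝ).real S = 1 - ε) :
    ∃ G : ProbabilityMeasure ℝ, F ∈ contaminationNhd G ε ∧
      ∀ t, cdf (G : Measure ℝ) t = (F : Measure ℝ).real (S ∩ Iic t) / (1 - ε) := by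
  have hne : (F : Measure ℝ) S ≠ 0 := fun h => by
    rw [measureReal_def, h, ENNReal.toReal_zero] at hFS
    linarith
  have hval : ∀ {T : Set ℝ} {c : ℝ}, (F : Measure ℝ).real T = c →
      (F : Measure ℝ) T = ENNReal.ofReal c := fun h => by
    rw [← h, ofReal_measureReal]
  have hscale : ∀ {T : Set ℝ} {c : ℝ}, (F : Measure ℝ).real T = c → 0 < c →
      ENNReal.ofReal c • (F : Measure ℝ)[|T] = (F : Measure ℝ).restrict T := fun h hc => by
    rw [ProbabilityTheory.cond, hval h, smul_smul, ENNReal.mul_inv_cancel (by simpa using hc)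
      ENNReal.ofReal_ne_top, one_smul]
  let G : ProbabilityMeasure ℝ := ⟨(F : Measure ℝ)[|S], cond_isProbabilityMeasure hne⟩
  have hG : (G : Measure ℝ) = (F : Measure ℝ)[|S] := rfl
  have hSc : (F : Measure ℝ).real Sᶜ = ε := by
    rw [probReal_compl_eq_one_sub hS, hFS]
    ring
  refine ⟨G, ?_, fun t => ?_⟩
  · rcases hε₀.eq_or_lt with rfl | hε
    -- The complement of `S` is null and cannot be conditioned on; the contaminant has weight zero,
    -- so any law serves.
    · refine ⟨F, ?_⟩
      rw [hG, hscale hFS (by linarith), ENNReal.ofReal_zero, zero_smul, add_zero]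
      symm
      refine Measure.restrict_eq_self_of_ae_mem ?_
      rw [ae_iff]
      have := hval hSc
      simpa [compl_def] using this
    · have hne' : (F : Measure ℝ) Sᶜ ≠ 0 := fun h => by
        rw [measureReal_def, h, ENNReal.toReal_zero] at hSc
        linarith
      refine ⟨⟨(F : Measure ℝ)[|Sᶜ], cond_isProbabilityMeasure hne'⟩, ?_⟩
      rw [hG, hscale hFS (by linarith)]
      change _ = _ + ENNReal.ofReal ε • (F : Measure ℝ)[|Sᶜ]
      rw [hscale hSc hε, Measure.restrict_add_restrict_compl hS]
  · rw [cdf_eq_real, hG, measureReal_def, cond_apply hS, ENNReal.toReal_mul, ENNReal.toReal_inv,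
      ← measureReal_def, ← measureReal_def, hFS, inv_mul_eq_div]

namespace IsCenteredDensity

variable {F : ProbabilityMeasure ℝ} {θ : ℝ} {f : ℝ → ℝ≥0∞} (h : IsCenteredDensity F θ f)
include h

lemma cdf_eq_iff {w : ℝ} (hw₀ : 0 < w) (hw₁ : w < 1) (t : ℝ) :
    cdf (F : Measure ℝ) t = w ↔ t = quantile F w := by
  have hq := cdf_quantile F h.continuous_cdf hw₀ hw₁
  refine ⟨fun ht => ?_, fun ht => ht ▸ hq⟩
  rcases lt_trichotomy t (quantile F w) with hlt | heq | hlt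
  · have := h.cdf_lt_cdf hlt (by linarith) (by linarith)
    linarith
  · exact heq
  · have := h.cdf_lt_cdf hlt (by linarith) (by linarith)
    linarith

/-- Both truncated laws have distribution function `g ∘ F`, and `g` takes the value `1/2` only at
`w`, so the median is the `w`-quantile of `F`. -/
lemma isContinuousUniqueMedian_of_cdf_comp {G : ProbabilityMeasure ℝ} {g : ℝ → ℝ} {w : ℝ}
    (hg : Continuous g) (hG : ∀ t, cdf (G : Measure ℝ) t = g (cdf (F : Measure ℝ) t))
    (hw₀ : 0 < w) (hw₁ : w < 1) (heq : ∀ u, g u = 1 / 2 ↔ u = w)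
    (hle : ∀ u, 1 / 2 ≤ g u ↔ w ≤ u) :
    IsContinuousUniqueMedian G ∧ quantile G (1 / 2) = quantile F w := by
  refine ⟨⟨?_, ?_⟩, ?_⟩
  · have : (cdf (G : Measure ℝ) : ℝ → ℝ) = fun t => g (cdf (F : Measure ℝ) t) := funext hG
    rw [this]
    exact hg.comp h.continuous_cdf
  · simp_rw [hG, heq, h.cdf_eq_iff hw₀ hw₁]
    exact ⟨_, rfl, fun _ h => h⟩
  · simp_rw [quantile, hG, hle]

/-- `F` is a contamination of its conditional distribution on an upper half-line, the median
of which is an upper quantile of `F`. -/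
lemma exists_upper_median {ε : ℝ} (hε₀ : 0 ≤ ε) (hε₁ : ε < 1) :
    ∃ G : ProbabilityMeasure ℝ, F ∈ contaminationNhd G ε ∧ IsContinuousUniqueMedian G ∧
      quantile G (1 / 2) = quantile F ((1 + ε) / 2) := by
  have hS : ∃ S : Set ℝ, MeasurableSet S ∧ (F : Measure ℝ).real S = 1 - ε ∧
      ∀ t, (F : Measure ℝ).real (S ∩ Iic t) = max (cdf (F : Measure ℝ) t - ε) 0 := by
    -- At `ε = 0` the cut would be a quantile of level `0`, which need not exist; the whole line is
    -- used instead.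
    rcases hε₀.eq_or_lt with rfl | hε
    · refine ⟨univ, MeasurableSet.univ, by simp, fun t => ?_⟩
      rw [univ_inter, sub_zero, max_eq_left (cdf_nonneg _ _), cdf_eq_real]
    · have hq := cdf_quantile F h.continuous_cdf hε hε₁
      refine ⟨Ioi (quantile F ε), measurableSet_Ioi, ?_, fun t => ?_⟩
      · rw [← compl_Iic, probReal_compl_eq_one_sub measurableSet_Iic, ← cdf_eq_real, hq]
      · rw [Ioi_inter_Iic]
        rcases le_total (quantile F ε) t with hqt | hqt
        · rw [← cdf_sub_cdf F hqt, hq, max_eq_left]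
          have := monotone_cdf (F : Measure ℝ) hqt
          linarith
        · rw [Ioc_eq_empty (not_lt.2 hqt), measureReal_empty, max_eq_right]
          have := monotone_cdf (F : Measure ℝ) hqt
          linarith
  obtain ⟨S, hSm, hFS, hScdf⟩ := hS
  obtain ⟨G, hG, hGcdf⟩ := exists_mem_contaminationNhd_of_real_eq F hε₀ hε₁ hSm hFS
  simp_rw [hScdf] at hGcdf
  have hpos : 0 < 1 - ε := by linarith
  refine ⟨G, hG, h.isContinuousUniqueMedian_of_cdf_comp (g := fun u => max (u - ε) 0 / (1 - ε))
    (by fun_prop) hGcdf (by linarith) (by linarith) (fun u => ?_) fun u => ?_⟩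
  · rw [div_eq_iff hpos.ne']
    rcases max_cases (u - ε) 0 with ⟨h1, h2⟩ | ⟨h1, h2⟩ <;> rw [h1] <;>
      constructor <;> intro h3 <;> linarith
  · rw [le_div_iff₀ hpos]
    rcases max_cases (u - ε) 0 with ⟨h1, h2⟩ | ⟨h1, h2⟩ <;> rw [h1] <;>
      constructor <;> intro h3 <;> linarith

/-- `F` is a contamination of its conditional distribution on a lower half-line, the median
of which is a lower quantile of `F`. -/
lemma exists_lower_median {ε : ℝ} (hε₀ : 0 ≤ ε) (hε₁ : ε < 1) :
    ∃ G : ProbabilityMeasure ℝ, F ∈ contaminationNhd G ε ∧ IsContinuousUniqueMedian G ∧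
      quantile G (1 / 2) = quantile F ((1 - ε) / 2) := by
  have hS : ∃ S : Set ℝ, MeasurableSet S ∧ (F : Measure ℝ).real S = 1 - ε ∧
      ∀ t, (F : Measure ℝ).real (S ∩ Iic t) = min (cdf (F : Measure ℝ) t) (1 - ε) := by
    rcases hε₀.eq_or_lt with rfl | hε
    · refine ⟨univ, MeasurableSet.univ, by simp, fun t => ?_⟩
      rw [univ_inter, sub_zero, min_eq_left (cdf_le_one _ _), cdf_eq_real]
    · have hq := cdf_quantile F h.continuous_cdf (p := 1 - ε) (by linarith) (by linarith)
      refine ⟨Iic (quantile F (1 - ε)), measurableSet_Iic, ?_, fun t => ?_⟩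
      · rw [← cdf_eq_real, hq]
      · rw [Iic_inter_Iic, ← cdf_eq_real, (monotone_cdf (F : Measure ℝ)).map_min, hq, min_comm]
  obtain ⟨S, hSm, hFS, hScdf⟩ := hS
  obtain ⟨G, hG, hGcdf⟩ := exists_mem_contaminationNhd_of_real_eq F hε₀ hε₁ hSm hFS
  simp_rw [hScdf] at hGcdf
  have hpos : 0 < 1 - ε := by linarith
  refine ⟨G, hG, h.isContinuousUniqueMedian_of_cdf_comp (g := fun u => min u (1 - ε) / (1 - ε))
    (by fun_prop) hGcdf (by linarith) (by linarith) (fun u => ?_) fun u => ?_⟩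
  · rw [div_eq_iff hpos.ne']
    rcases min_cases u (1 - ε) with ⟨h1, h2⟩ | ⟨h1, h2⟩ <;> rw [h1] <;>
      constructor <;> intro h3 <;> linarith
  · rw [le_div_iff₀ hpos]
    rcases min_cases u (1 - ε) with ⟨h1, h2⟩ | ⟨h1, h2⟩ <;> rw [h1] <;>
      constructor <;> intro h3 <;> linarith

end IsCenteredDensity

lemma measurable_sample (n : ℕ) : Measurable (sample n) :=
  measurable_pi_lambda _ fun i => measurable_pi_apply (i : ℕ)

/-- Intervals with robust coverage cannot almost surely miss the median eventually. -/
lemma not_ae_eventually_miss {F G : ProbabilityMeasure ℝ} {α ε : ℝ} (hα₁ : α < 1)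
    {A B : (n : ℕ) → (Fin n → ℝ) → ℝ} {β : ℕ → ℝ} {n₀ : ℕ}
    (hA : ∀ n, Measurable (A n)) (hB : ∀ n, Measurable (B n)) (hβ : Tendsto β atTop (𝓝 α))
    (hcov : ∀ n, n₀ ≤ n → HasNonparametricRobustCoverage (A n) (B n) ε (β n))
    (hFG : F ∈ contaminationNhd G ε) (hG : IsContinuousUniqueMedian G) :
    ¬ ∀ᵐ x ∂(sampleLaw F), ∀ᶠ n in atTop, ¬ (A n (sample n x) ≤ quantile G (1 / 2) ∧
      quantile G (1 / 2) < B n (sample n x)) := by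
  intro h
  have hlim := tendsto_measureReal_zero_of_ae_eventually_notMem
    (E := fun n => {x | A n (sample n x) ≤ quantile G (1 / 2) ∧
      quantile G (1 / 2) < B n (sample n x)})
    (fun n => (measurableSet_le ((hA n).comp (measurable_sample n)) measurable_const).inter
      (measurableSet_lt measurable_const ((hB n).comp (measurable_sample n)))) h
  -- As `F` is in the neighborhood of `G`, coverage under `F` is at least `1 - β n`; vanishing
  -- coverage would force `1 - α ≤ 0`.
  have := le_of_tendsto_of_tendsto (hβ.const_sub 1) hlim (by
    filter_upwards [eventually_ge_atTop n₀] with n hn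
    exact (hcov n hn G hG).1 ⟨F, hFG, rfl⟩)
  linarith

end RobustInterval

theorem theorem2 (F : ProbabilityMeasure ℝ) (θ α ε : ℝ) (k : ℕ → ℕ)
    (hF : RobustInterval.HasSymmetricUnimodalDensity F θ)
    (hα₀ : 0 < α) (hα₁ : α < 1) (hε₀ : 0 ≤ ε) (hε₁ : ε < 1 / 2)
    (hk : ∀ n : ℕ, 1 ≤ n → RobustInterval.IsOptimalIndex α ε n (k n)) :
    -- the levels of the chosen intervals converge to the nominal one
    Tendsto (fun n : ℕ => RobustInterval.alphaStar n (k n) ε) atTop (𝓝 α) ∧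
    -- maximum asymptotic length
    (∀ δ : ℝ, 0 ≤ δ → δ < (1 - ε) / 2 →
      RobustInterval.maxAsymptoticLength
          (RobustInterval.lowerEnd k) (RobustInterval.upperEnd k) F δ =
        ((RobustInterval.quantile F ((1 + ε) / (2 * (1 - δ))) -
          RobustInterval.quantile F ((1 - ε) / (2 * (1 - δ))) : ℝ) : EReal)) ∧
    -- length breakdown point
    RobustInterval.lengthBreakdownPoint
        (RobustInterval.lowerEnd k) (RobustInterval.upperEnd k) F = (1 - ε) / 2 ∧
    -- robust length at the design contamination
    (RobustInterval.HasRobustLength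
        (RobustInterval.lowerEnd k) (RobustInterval.upperEnd k) F ε ↔ ε < 1 / 3) ∧
    -- optimality among nonparametric robust intervals with convergent endpoints
    (∀ (A B : (n : ℕ) → (Fin n → ℝ) → ℝ) (β : ℕ → ℝ) (n₀ : ℕ) (A₀ B₀ : ℝ),
      (∀ n, Measurable (A n)) → (∀ n, Measurable (B n)) →
      Tendsto β atTop (𝓝 α) →
      (∀ n, n₀ ≤ n →
        RobustInterval.HasNonparametricRobustCoverage (A n) (B n) ε (β n)) →
      (∀ᵐ x ∂(RobustInterval.sampleLaw F),
        Tendsto (fun n => A n (RobustInterval.sample n x)) atTop (𝓝 A₀)) →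
      (∀ᵐ x ∂(RobustInterval.sampleLaw F),
        Tendsto (fun n => B n (RobustInterval.sample n x)) atTop (𝓝 B₀)) →
      RobustInterval.quantile F ((1 + ε) / 2) ≤ B₀ ∧
        A₀ ≤ RobustInterval.quantile F ((1 - ε) / 2)) := by
  open RobustInterval in
  obtain ⟨f, hf⟩ := hF.exists_isCenteredDensity
  refine ⟨tendsto_alphaStar hα₀ hα₁ hε₀ hε₁ hk,
    fun δ hδ₀ hδ₁ => maxAsymptoticLength_eq hk hα₀ hα₁ hε₀ hε₁ hF hδ₀ hδ₁,
    lengthBreakdownPoint_eq hk hα₀ hα₁ hε₀ hε₁ hF, ?_, ?_⟩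
  · rw [hasRobustLength_iff hk hα₀ hα₁ hε₀ hε₁ hF hε₀ hε₁]
    constructor <;> intro h <;> linarith
  · intro A B β n₀ A₀ B₀ hA hB hβ hcov hA₀ hB₀
    constructor
    · by_contra! hcon
      obtain ⟨G, hFG, hG, hmed⟩ := hf.exists_upper_median hε₀ (by linarith)
      refine not_ae_eventually_miss hα₁ hA hB hβ hcov hFG hG ?_
      rw [hmed]
      filter_upwards [hB₀] with x hx
      filter_upwards [hx.eventually_lt_const hcon] with n hn h
      exact absurd h.2 (not_lt.2 hn.le)
    · by_contra! hcon
      obtain ⟨G, hFG, hG, hmed⟩ := hf.exists_lower_median hε₀ (by linarith)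
      refine not_ae_eventually_miss hα₁ hA hB hβ hcov hFG hG ?_
      rw [hmed]
      filter_upwards [hA₀] with x hx
      filter_upwards [hx.eventually_const_lt hcon] with n hn h
      exact absurd h.1 (not_le.2 hn)
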